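/- For an integer $k\ge 1$ and $|q|<1$ let $S_k(q)=\sum_{n\ge1}\frac1{n^k}\frac{q^n}{1-q^n}$, and for $\Im z>0$ let $P_k(z)=S_k(e^{2\pi i z})$. For odd $k>1$ let $$R_k(z)=\frac{z^{k-1}-1}{2}\zeta(k)+\frac{(2\pi i)^k}{2z}\sum_{m=0}^{(k+1)/2}z^{2m}\frac{\mathcal B_{2m}}{(2m)!}\frac{\mathcal B_{k+1-2m}}{(k+1-2m)!},$$ where $\mathcal B_j$ are the Bernoulli numbers, and define $$T_k(z)=P_k(z)-\frac{2zP_k'(z)}{k-1},\qquad U_k(z)=R_k(z)-\frac{2zR_k'(z)}{k-1}.$$ Write $\sqrt{-s}=i\sqrt s$ for $s>0$. Then: (1) For every odd $k>1$ and every $z$ with $\Im z>0$, the Lambert series defining $P_k(z)$ converges absolutely, $P_k$ and $R_k$ are complex differentiable at $z$, and $$z^{k-1}U_k(-1/z)=U_k(z),\qquad z^{k-1}T_k(-1/z)=U_k(z)-T_k(z).$$ In particular $T_k(i)=\frac12U_k(i)$ for $k=4n+1$, $n\ge1$. (2) For every $n\ge1$ there are evaluations of the following forms, in which $a$ and the $c_d$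 are rational numbers (depending on $k$ and on the family): - Family A, $k=2n+1$: $\zeta(k)=a\sqrt7\,\pi^k+\sum_{d\in\{1,2,4\}}c_d\,T_k\!\left(\tfrac d2\sqrt{-7}\right)$; - Family B, $k=2n+1$: $\zeta(k)=a\sqrt2\,\pi^k+\sum_{d\in\{2,3,6\}}c_d\,T_k\!\left(\tfrac d2\sqrt{-2}\right)$; - Family C, $k=4n-1$: $\zeta(k)=a\,\pi^k+\sum_{d\in\{3,4,6,12\}}c_d\,T_k\!\left(\tfrac d2\sqrt{-1}\right)$; - Family D, $k=4n-1$: $\zeta(k)=a\,\pi^k+\sum_{d\in\{4,5,10,20\}}c_d\,T_k\!\left(\tfrac d2\sqrt{-1}\right)$; - Family E, $k=6n-3$: $\zeta(k)=a\sqrt3\,\pi^k+\sum_{d\in\{2,3,6,12\}}c_d\,T_k\!\left(\tfrac d2\sqrt{-3}\right)$. (3) At $k=3$ these five families give \begin{align*} \zeta(3)&=\tfrac{7\sqrt7}{480}\pi^3+\tfrac52T_3(\tfrac12\sqrt{-7})-\tfrac{41}8T_3(\sqrt{-7})+\tfrac58T_3(2\sqrt{-7})\\ &=\tfrac{47\sqrt2}{1710}\pi^3-\tfrac{44}{19}T_3(\sqrt{-2})+\tfrac{4}{19}T_3(\tfrac32\sqrt{-2})+\tfrac{2}{19}T_3(3\sqrt{-2})\\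 &=\tfrac{7}{180}\pi^3-4T_3(\tfrac32\sqrt{-1})-8T_3(2\sqrt{-1})+11T_3(3\sqrt{-1})-T_3(6\sqrt{-1})\\ &=\tfrac{221}{5700}\pi^3-\tfrac{232}{95}T_3(2\sqrt{-1})-\tfrac{28}{95}T_3(\tfrac52\sqrt{-1})+\tfrac{77}{95}T_3(5\sqrt{-1})-\tfrac{7}{95}T_3(10\sqrt{-1})\\ &=\tfrac{43\sqrt3}{1920}\pi^3-\tfrac{25}{8}T_3(\sqrt{-3})-\tfrac{9}{8}T_3(\tfrac32\sqrt{-3})+\tfrac{81}{32}T_3(3\sqrt{-3})-\tfrac{9}{32}T_3(6\sqrt{-3}). \end{align*} -/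

import Mathlib

noncomputable section

/-- The Lambert series `S_k(q) = ∑_{n ≥ 1} n^{-k} q^n / (1 - q^n)`; it converges for `‖q‖ < 1`. -/
def lambertS (k : ℕ) (q : ℂ) : ℂ :=
  ∑' n : ℕ, 1 / ((n : ℂ) + 1) ^ k * (q ^ (n + 1) / (1 - q ^ (n + 1)))

/-- `P_k(z) = S_k(exp(2πiz))`, used for `z` in the upper half-plane. -/
def lambertP (k : ℕ) (z : ℂ) : ℂ :=
  lambertS k (Complex.exp (2 * (Real.pi : ℂ) * Complex.I * z))

/-- The correction term
`R_k(z) = (z^{k-1} - 1)/2 · ζ(k)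
  + (2πi)^k/(2z) · ∑_{m=0}^{(k+1)/2} z^{2m} B_{2m}/(2m)! · B_{k+1-2m}/(k+1-2m)!`, for odd `k > 1`. -/
def corrR (k : ℕ) (z : ℂ) : ℂ :=
  (z ^ (k - 1) - 1) / 2 * riemannZeta (k : ℂ)
    + (2 * (Real.pi : ℂ) * Complex.I) ^ k / (2 * z)
      * ∑ m ∈ Finset.range ((k + 1) / 2 + 1),
          z ^ (2 * m) * ((bernoulli (2 * m) : ℂ) / ((2 * m).factorial : ℂ))
            * ((bernoulli (k + 1 - 2 * m) : ℂ) / ((k + 1 - 2 * m).factorial : ℂ))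

/-- `T_k(z) = P_k(z) - 2 z P_k'(z) / (k - 1)`, with the complex derivative. -/
def derivT (k : ℕ) (z : ℂ) : ℂ :=
  lambertP k z - 2 * z * deriv (lambertP k) z / ((k : ℂ) - 1)

/-- `U_k(z) = R_k(z) - 2 z R_k'(z) / (k - 1)`, with the complex derivative. -/
def derivU (k : ℕ) (z : ℂ) : ℂ :=
  corrR k z - 2 * z * deriv (corrR k) z / ((k : ℂ) - 1)

/-- `√(-s) = i √s` for a natural number `s`. -/
def sqrtNeg (s : ℕ) : ℂ := (Real.sqrt (s : ℝ) : ℂ) * Complex.I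

end

/-! Ramanujan's formula `lambertP_sub` says that `P_k(z) - z^(k-1) P_k(-1/z) = R_k(z)`. Summing the
partial fractions of the cotangent writes `P_k` as an absolutely convergent double series.
Interchanging its two indices amounts to `z ↦ -1/z`, up to a finite geometric sum of products of
even zeta values. Differentiating the formula gives the laws for `T_k` and `U_k`.

For the evaluations, `T_k` is replaced by `maassT`, in which `2z` becomes `z - z̄`. The two agree on
the imaginary axis, and `maassT` has four properties: it is 1-periodic; reflection `z ↦ -z̄`
conjugates it; it transforms under `z ↦ -1/z` with factor `z̄ z^(k-2)`; and it obeys the same Hecke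
relation at every prime `p` as `P_k` does (`maassT_hecke`).

At a point of `ℚ(√-s)` a Hecke relation involves the points `(z + j)/p`. For the chosen points,
inversion, translation and reflection carry these back to a short list. If `2 Re z` is an integer
then `maassT` is real at `z`, so the real part of the inversion law has rational coefficients, up to
a rational multiple of `ζ(k)` and one of `√s π^k` (`reT_neg_one_div`). The outcome is one or two
rational linear relations between `ζ(k)`, `√s π^k`, the listed values and at most one unwanted
value. Eliminating the latter leaves `ζ(k)` with a coefficient that must not vanish.

In families A and B the bound `|ρ| ≤ |z|^(-(k-1))` on the inversion coefficient is enough. In C, D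
and E the leading terms of the determinant cancel, so exact values of the coefficients are needed.
They are available because `k - 3` is a multiple of 4 or of 6, and the relevant powers `z^4` or
`z^6` are rational; the one coefficient in D without a closed form only needs a bound. -/

open Complex

/-! ### Lambert series -/

/-- The nome `exp (2πiz)`. -/
noncomputable def nome (z : ℂ) : ℂ := exp (2 * (Real.pi : ℂ) * I * z)

theorem nome_pow (z : ℂ) (n : ℕ) : nome z ^ n = nome (n * z) := by
  rw [nome, nome, ← exp_nat_mul]; ring_nf

theorem nome_add (z w : ℂ) : nome (z + w) = nome z * nome w := by
  rw [nome, nome, nome, ← exp_add]; ring_nf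

theorem nome_natCast (n : ℕ) : nome n = 1 := by
  rw [nome, exp_eq_one_iff]; exact ⟨n, by push_cast; ring⟩

theorem norm_nome_lt_one {z : ℂ} (hz : 0 < z.im) : ‖nome z‖ < 1 :=
  UpperHalfPlane.norm_exp_two_pi_I_lt_one ⟨z, hz⟩

theorem nome_ne_one {z : ℂ} (hz : 0 < z.im) : nome z ≠ 1 := fun h => by
  simpa [h] using norm_nome_lt_one hz

theorem differentiable_nome : Differentiable ℂ nome := by
  unfold nome; fun_prop

/-- The denominator is at least `1 - r` in norm because `r ^ (n + 1) ≤ r`. The bound is uniform on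
`‖q‖ ≤ r`, so it serves both for absolute convergence and for holomorphy. -/
theorem norm_lambert_term_le {q : ℂ} {r : ℝ} (hq : ‖q‖ ≤ r) (hr : r < 1) (k n : ℕ) :
    ‖1 / ((n : ℂ) + 1) ^ k * (q ^ (n + 1) / (1 - q ^ (n + 1)))‖ ≤ r ^ n * (1 / (1 - r)) := by
  have h0 : 0 ≤ r := (norm_nonneg q).trans hq
  have h1 : ‖1 / ((n : ℂ) + 1) ^ k‖ ≤ 1 := by
    have : ‖((n : ℂ) + 1)‖ = (n : ℝ) + 1 := by
      rw [← Nat.cast_succ, norm_natCast, Nat.cast_succ]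
    rw [norm_div, norm_pow, this, norm_one]
    exact div_le_one_of_le₀ (one_le_pow₀ (by linarith [n.cast_nonneg (α := ℝ)])) (by positivity)
  have h2 : ‖q ^ (n + 1)‖ ≤ r ^ (n + 1) := by
    rw [norm_pow]; exact pow_le_pow_left₀ (norm_nonneg q) hq _
  have h3 : r ^ (n + 1) ≤ r ^ n := pow_le_pow_of_le_one h0 hr.le (Nat.le_succ n)
  have h4 : 1 - r ≤ ‖1 - q ^ (n + 1)‖ := by
    have h5 : r ^ (n + 1) ≤ r := pow_le_of_le_one h0 hr.le (Nat.succ_ne_zero n)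
    have h6 := norm_sub_norm_le (1 : ℂ) (q ^ (n + 1))
    rw [norm_one] at h6
    linarith
  have h7 : 0 < 1 - r := by linarith
  rw [norm_mul, norm_div (q ^ (n + 1)), div_eq_mul_one_div ‖q ^ (n + 1)‖]
  calc _ ≤ 1 * (r ^ n * (1 / (1 - r))) := by
        gcongr
        exact h2.trans h3
    _ = _ := one_mul _

theorem summable_lambert {q : ℂ} (hq : ‖q‖ < 1) (k : ℕ) :
    Summable fun n : ℕ => 1 / ((n : ℂ) + 1) ^ k * (q ^ (n + 1) / (1 - q ^ (n + 1))) :=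
  Summable.of_norm_bounded ((summable_geometric_of_lt_one (norm_nonneg q) hq).mul_right _)
    fun n => norm_lambert_term_le le_rfl hq k n

theorem differentiableAt_lambertS (k : ℕ) {q : ℂ} (hq : ‖q‖ < 1) :
    DifferentiableAt ℂ (lambertS k) q := by
  obtain ⟨r, hqr, hr⟩ := exists_between hq
  have h0 : 0 ≤ r := (norm_nonneg q).trans hqr.le
  have hne : ∀ w ∈ Metric.ball (0 : ℂ) r, ∀ n : ℕ, 1 - w ^ (n + 1) ≠ 0 := by
    intro w hw n h
    rw [mem_ball_zero_iff] at hw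
    have h1 : ‖w ^ (n + 1)‖ = 1 := by rw [← sub_eq_zero.mp h, norm_one]
    rw [norm_pow] at h1
    exact (pow_lt_one₀ (norm_nonneg w) (hw.trans hr) (Nat.succ_ne_zero n)).ne h1
  have h : DifferentiableOn ℂ (lambertS k) (Metric.ball 0 r) := by
    refine differentiableOn_tsum_of_summable_norm
      ((summable_geometric_of_lt_one h0 hr).mul_right (1 / (1 - r))) (fun n => ?_)
      Metric.isOpen_ball fun n w hw => norm_lambert_term_le (mem_ball_zero_iff.mp hw).le hr k n
    exact DifferentiableOn.const_mul (DifferentiableOn.div (by fun_prop) (by fun_prop)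
      fun w hw => hne w hw n) _
  exact h.differentiableAt (Metric.isOpen_ball.mem_nhds (mem_ball_zero_iff.mpr hqr))

theorem differentiableAt_lambertP (k : ℕ) {z : ℂ} (hz : 0 < z.im) :
    DifferentiableAt ℂ (lambertP k) z :=
  (differentiableAt_lambertS k (norm_nome_lt_one hz)).comp z (differentiable_nome z)

/-- The function `e(z) / (1 - e(z))`, `e(z) = exp (2πiz)`. -/
noncomputable def lambertKernel (z : ℂ) : ℂ := nome z / (1 - nome z)

theorem hasSum_lambertP (k : ℕ) {z : ℂ} (hz : 0 < z.im) :
    HasSum (fun n : ℕ => 1 / ((n : ℂ) + 1) ^ k * lambertKernel (((n : ℂ) + 1) * z))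
      (lambertP k z) := by
  have h := (summable_lambert (norm_nome_lt_one hz) k).hasSum
  refine h.congr_fun ?_
  intro n
  simp [nome_pow, lambertKernel]

theorem lambertP_add_intCast (k : ℕ) (z : ℂ) (n : ℤ) : lambertP k (z + n) = lambertP k z := by
  have h : nome n = 1 := by rw [nome, exp_eq_one_iff]; exact ⟨n, by ring⟩
  change lambertS k (nome _) = lambertS k (nome _)
  rw [nome_add, h, mul_one]

theorem lambertP_neg_conj (k : ℕ) (z : ℂ) :
    lambertP k (-(starRingEnd ℂ) z) = (starRingEnd ℂ) (lambertP k z) := by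
  have h : nome (-(starRingEnd ℂ) z) = (starRingEnd ℂ) (nome z) := by
    rw [nome, nome, ← exp_conj]; simp [conj_ofNat]
  change lambertS k (nome _) = (starRingEnd ℂ) (lambertS k (nome _))
  rw [h, lambertS, lambertS, conj_tsum]
  simp

/-! ### Hecke relations -/

/-- Write `u / (1 - u) = (∑_{i<p} u^i) / (1 - u^p) - 1` with `u = ζ^j y`. Here `u^p = y^p` does not
depend on `j`, and orthogonality of roots of unity leaves only `i = 0`. -/
theorem sum_primitiveRoot_div {p : ℕ} (hp : 0 < p) {ζ y : ℂ} (hζ : IsPrimitiveRoot ζ p)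
    (hy : y ^ p ≠ 1) :
    ∑ j ∈ Finset.range p, ζ ^ j * y / (1 - ζ ^ j * y) = p * (y ^ p / (1 - y ^ p)) := by
  have hy' : 1 - y ^ p ≠ 0 := sub_ne_zero.mpr hy.symm
  have h1 : ∀ j ∈ Finset.range p, ζ ^ j * y / (1 - ζ ^ j * y) =
      (∑ i ∈ Finset.range p, (ζ ^ i) ^ j * y ^ i) / (1 - y ^ p) - 1 := by
    intro j _
    have hu : (ζ ^ j * y) ^ p = y ^ p := by
      rw [mul_pow, ← pow_mul, mul_comm j p, pow_mul, hζ.pow_eq_one, one_pow, one_mul]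
    have hu1 : 1 - ζ ^ j * y ≠ 0 := fun h => hy' <| by
      rw [← hu, ← sub_eq_zero.mp h, one_pow, sub_self]
    have hg := geom_sum_mul (ζ ^ j * y) p
    rw [hu] at hg
    have hs : ∑ i ∈ Finset.range p, (ζ ^ i) ^ j * y ^ i =
        ∑ i ∈ Finset.range p, (ζ ^ j * y) ^ i := by
      refine Finset.sum_congr rfl fun i _ => ?_
      rw [mul_pow, ← pow_mul, ← pow_mul, mul_comm i j]
    rw [hs]
    field_simp
    linear_combination hg
  rw [Finset.sum_congr rfl h1, Finset.sum_sub_distrib, ← Finset.sum_div, Finset.sum_comm]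
  have h2 : ∀ i ∈ Finset.range p, ∑ j ∈ Finset.range p, (ζ ^ i) ^ j * y ^ i =
      if i = 0 then (p : ℂ) else 0 := by
    intro i hi
    rw [← Finset.sum_mul]
    split_ifs with h
    · simp [h]
    · have h3 : ζ ^ i ≠ 1 := hζ.pow_ne_one_of_pos_of_lt h (Finset.mem_range.mp hi)
      have h4 := geom_sum_mul (ζ ^ i) p
      rw [← pow_mul, mul_comm i p, pow_mul, hζ.pow_eq_one, one_pow, sub_self] at h4
      rw [(mul_eq_zero.mp h4).resolve_right (sub_ne_zero.mpr h3), zero_mul]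
  rw [Finset.sum_congr rfl h2, Finset.sum_ite_eq' , if_pos (Finset.mem_range.mpr hp)]
  simp only [Finset.sum_const, Finset.card_range, nsmul_eq_mul, mul_one]
  field_simp
  ring

theorem sum_lambertKernel_of_dvd {p : ℕ} (hp : 0 < p) (z : ℂ) (n : ℕ) :
    ∑ j ∈ Finset.range p, lambertKernel ((p * n : ℕ) * ((z + j) / p)) =
      p * lambertKernel (n * z) := by
  have hp' : (p : ℂ) ≠ 0 := by exact_mod_cast hp.ne'
  have : ∀ j ∈ Finset.range p, lambertKernel ((p * n : ℕ) * ((z + j) / p)) =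
      lambertKernel (n * z) := by
    intro j _
    have : ((p * n : ℕ) : ℂ) * ((z + j) / p) = n * z + (n * j : ℕ) := by
      push_cast; field_simp
    rw [this, lambertKernel, nome_add, nome_natCast, mul_one, lambertKernel]
  rw [Finset.sum_congr rfl this]
  simp

theorem sum_lambertKernel_of_coprime {p n : ℕ} (hp : 0 < p) (hn : n.Coprime p) (hn0 : 0 < n)
    {z : ℂ} (hz : 0 < z.im) :
    ∑ j ∈ Finset.range p, lambertKernel (n * ((z + j) / p)) = p * lambertKernel (n * z) := by
  have hp' : (p : ℂ) ≠ 0 := by exact_mod_cast hp.ne'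
  have hζ := (isPrimitiveRoot_exp p hp.ne').pow_of_coprime n hn
  have hy : nome (n * z / p) ^ p = nome (n * z) := by
    rw [nome_pow, mul_div_cancel₀ _ hp']
  have hy1 : nome (n * z / p) ^ p ≠ 1 := by
    rw [hy]; apply nome_ne_one
    have : (0 : ℝ) < n := by exact_mod_cast hn0
    simpa using mul_pos this hz
  have h := sum_primitiveRoot_div hp hζ hy1
  rw [hy] at h
  rw [lambertKernel, ← h]
  refine Finset.sum_congr rfl fun j _ => ?_
  have : nome (n * ((z + j) / p)) =
      (exp (2 * Real.pi * I / p) ^ n) ^ j * nome (n * z / p) := by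
    rw [← pow_mul, ← exp_nat_mul, nome, nome, ← exp_add]
    congr 1
    push_cast
    field_simp
    ring
  rw [lambertKernel, this]

theorem im_natCast_mul_pos {n : ℕ} (hn : 0 < n) {z : ℂ} (hz : 0 < z.im) :
    0 < ((n : ℂ) * z).im := by
  have : (0 : ℝ) < n := by exact_mod_cast hn
  simpa using mul_pos this hz

theorem im_add_natCast_div_pos {p : ℕ} (hp : 0 < p) {z : ℂ} (hz : 0 < z.im) (j : ℕ) :
    0 < ((z + j) / p).im := by
  have : (0 : ℝ) < p := by exact_mod_cast hp
  simpa [div_natCast_im] using div_pos hz this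

/-- The Hecke relation at `p` for the Lambert series. -/
theorem lambertP_hecke (k : ℕ) {p : ℕ} (hp : p.Prime) {z : ℂ} (hz : 0 < z.im) :
    ∑ j ∈ Finset.range p, lambertP k ((z + j) / p) =
      p * lambertP k z + (1 / (p : ℂ) ^ k) * (p * lambertP k z - p * lambertP k (p * z)) := by
  have hp' : (p : ℂ) ≠ 0 := by exact_mod_cast hp.ne_zero
  have h1 := hasSum_sum fun j (_ : j ∈ Finset.range p) =>
    hasSum_lambertP k (im_add_natCast_div_pos hp.pos hz j)
  have h2 := (hasSum_lambertP k hz).mul_left (p : ℂ)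
  have h3 := (h2.sub ((hasSum_lambertP k (im_natCast_mul_pos hp.pos hz)).mul_left
    (p : ℂ))).mul_left (1 / (p : ℂ) ^ k)
  -- `f` is the excess over `p * lambertP k z`, term by term. It vanishes unless `p ∣ n + 1`, and
  -- `g` enumerates those indices, the shift by one coming from sums that start at `n + 1 = 1`.
  let f : ℕ → ℂ := fun n => ∑ j ∈ Finset.range p,
    1 / ((n : ℂ) + 1) ^ k * lambertKernel (((n : ℂ) + 1) * ((z + j) / p)) -
    p * (1 / ((n : ℂ) + 1) ^ k * lambertKernel (((n : ℂ) + 1) * z))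
  let g : ℕ → ℕ := fun n => p * (n + 1) - 1
  have hg1 : ∀ n, g n + 1 = p * (n + 1) := fun n =>
    Nat.sub_add_cancel (Nat.mul_pos hp.pos n.succ_pos)
  have hg : Function.Injective g := fun a b hab => by
    have h : p * (a + 1) = p * (b + 1) := by rw [← hg1, ← hg1, hab]
    exact Nat.succ_injective (Nat.eq_of_mul_eq_mul_left hp.pos h)
  have hf0 : ∀ n, n ∉ Set.range g → f n = 0 := by
    intro n hn
    have hc : (n + 1).Coprime p := by
      rw [Nat.coprime_comm, hp.coprime_iff_not_dvd]
      rintro ⟨m, hm⟩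
      refine hn ⟨m - 1, ?_⟩
      have hm0 : m ≠ 0 := by rintro rfl; simp at hm
      have : g (m - 1) + 1 = n + 1 := by
        rw [hg1, Nat.sub_add_cancel (Nat.one_le_iff_ne_zero.mpr hm0), hm]
      exact Nat.succ_injective this
    have h := sum_lambertKernel_of_coprime hp.pos hc n.succ_pos hz
    push_cast at h
    simp only [f]
    rw [← Finset.mul_sum, h]
    ring
  have hfg : HasSum (f ∘ g) ((1 / (p : ℂ) ^ k) *
      (p * lambertP k z - p * lambertP k (p * z))) := by
    refine h3.congr_fun ?_
    intro n
    have hN : ((g n : ℂ) + 1) = p * (n + 1) := by exact_mod_cast hg1 n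
    have h := sum_lambertKernel_of_dvd hp.pos z (n + 1)
    push_cast at h
    simp only [f, Function.comp_apply]
    rw [← Finset.mul_sum, hN, h, mul_pow, mul_left_comm (n + 1 : ℂ),
      mul_assoc (p : ℂ)]
    field_simp
  have h4 := ((hg.hasSum_iff hf0).mp hfg)
  have h5 := h2.add h4
  refine h1.unique ?_
  refine h5.congr_fun ?_
  intro n
  simp only [f]
  ring

/-! ### Ramanujan's formula -/

theorem hasSum_riemannZeta {k : ℕ} (hk : 1 < k) :
    HasSum (fun n : ℕ => 1 / ((n : ℂ) + 1) ^ k) (riemannZeta k) := by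
  have hs : Summable fun n : ℕ => 1 / (n : ℂ) ^ k := by
    refine Summable.of_norm ?_
    simpa using Real.summable_one_div_nat_pow.mpr hk
  have h := hs.hasSum
  rw [← zeta_nat_eq_tsum_of_gt_one hk, ← hasSum_nat_add_iff' 1] at h
  simpa [(zero_lt_one.trans hk).ne'] using h

/-- This is the Mittag-Leffler expansion of `π cot(πx)`, with the cotangent rewritten as `2i(-1/2 -
e/(1 - e))`, `e = exp(2πix)`. -/
theorem lambertKernel_hasSum {x : ℂ} (hx : 0 < x.im) :
    HasSum (fun m : ℕ => 2 * x / (x ^ 2 - ((m : ℂ) + 1) ^ 2))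
      (2 * Real.pi * I * (-1 / 2 - lambertKernel x) - 1 / x) := by
  have hc : x ∈ integerComplement := UpperHalfPlane.coe_mem_integerComplement ⟨x, hx⟩
  have h := (summable_cotTerm hc).hasSum
  have h1 : ∑' n : ℕ, cotTerm x n = Real.pi * cot (Real.pi * x) - 1 / x := (cot_series_rep' hc).symm
  have h2 : 1 - nome x ≠ 0 := sub_ne_zero.mpr (nome_ne_one hx).symm
  have h3 : (Real.pi : ℂ) * cot (Real.pi * x) - 1 / x =
      2 * Real.pi * I * (-1 / 2 - lambertKernel x) - 1 / x := by
    rw [cot_pi_eq_exp_ratio, lambertKernel]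
    change (Real.pi : ℂ) * ((nome x + 1) / (I * (1 - nome x))) - _ = _
    have hI : I ≠ 0 := I_ne_zero
    field_simp
    linear_combination (Real.pi : ℂ) * (nome x + 1) * I_sq
  rw [h1, h3] at h
  refine h.congr_fun fun m => ?_
  rw [cotTerm_identity hc, mul_one_div]
  ring_nf

/-- The terms of the double series for `lambertP k z`. -/
noncomputable def latticeTerm (k : ℕ) (z : ℂ) (x : ℕ × ℕ) : ℂ :=
  1 / ((x.1 : ℂ) + 1) ^ (k - 1) *
    (2 * z / ((((x.1 : ℂ) + 1) * z) ^ 2 - ((x.2 : ℂ) + 1) ^ 2))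

/-- Multiplying by `z̄` makes the `a`-part real. The resulting bound is uniform in `a`, so the
denominator of `latticeTerm` is controlled by the second index alone and `1 / n^(k-1)` is left to
sum over the first. -/
theorem le_norm_ofReal_mul_add {z : ℂ} (a b : ℝ) :
    |b| * |z.im| ≤ ‖(a * z + b : ℂ)‖ * ‖z‖ := by
  have h : (((a * z + b : ℂ)) * (starRingEnd ℂ) z).im = -(b * z.im) := by
    simp
    ring
  have h1 := abs_im_le_norm ((a * z + b : ℂ) * (starRingEnd ℂ) z)
  rwa [h, abs_neg, abs_mul, norm_mul, norm_conj] at h1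

theorem le_norm_sq_sub_sq {z : ℂ} (hz : 0 < z.im) (a b : ℝ) :
    b ^ 2 * (z.im / ‖z‖) ^ 2 ≤ ‖((a * z) ^ 2 - b ^ 2 : ℂ)‖ := by
  have hz0 : 0 < ‖z‖ := norm_pos_iff.mpr fun h => by simp [h] at hz
  have h1 := le_norm_ofReal_mul_add (z := z) a b
  have h2 := le_norm_ofReal_mul_add (z := z) a (-b)
  rw [abs_neg] at h2
  have h3 := mul_le_mul h1 h2 (by positivity) (by positivity)
  have h4 : ((a * z) ^ 2 - b ^ 2 : ℂ) = (a * z + b) * (a * z + (-b : ℝ)) := by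
    push_cast; ring
  rw [h4, norm_mul, div_pow, ← mul_div_assoc, div_le_iff₀ (by positivity)]
  calc b ^ 2 * z.im ^ 2 = |b| * |z.im| * (|b| * |z.im|) := by
        rw [mul_mul_mul_comm, abs_mul_abs_self, abs_mul_abs_self]; ring
    _ ≤ _ := h3
    _ = _ := by ring

theorem summable_latticeTerm {k : ℕ} (hk : 3 ≤ k) {z : ℂ} (hz : 0 < z.im) :
    Summable (latticeTerm k z) := by
  have hz0 : 0 < ‖z‖ := norm_pos_iff.mpr fun h => by simp [h] at hz
  set c := (z.im / ‖z‖) ^ 2 with hc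
  have hc0 : 0 < c := by positivity
  have hs : Summable fun n : ℕ => 1 / ((n : ℝ) + 1) ^ 2 := by
    have := (summable_nat_add_iff 1).mpr (Real.summable_one_div_nat_pow.mpr one_lt_two)
    simpa using this
  have hs2 := (hs.mul_of_nonneg hs (fun n => by positivity)
    (fun n => by positivity)).mul_right (2 * ‖z‖ / c)
  refine Summable.of_norm_bounded hs2 fun x => ?_
  have h1 := le_norm_sq_sub_sq hz ((x.1 : ℝ) + 1) ((x.2 : ℝ) + 1)
  push_cast at h1
  have h2 : ‖((x.1 : ℂ) + 1)‖ = (x.1 : ℝ) + 1 := by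
    rw [← Nat.cast_succ, norm_natCast, Nat.cast_succ]
  rw [latticeTerm, norm_mul, norm_div, norm_div, norm_mul, norm_pow, h2, norm_one, norm_ofNat]
  calc _ ≤ 1 / ((x.1 : ℝ) + 1) ^ 2 * (2 * ‖z‖ / (((x.2 : ℝ) + 1) ^ 2 * c)) := by
        gcongr
        · linarith [x.1.cast_nonneg (α := ℝ)]
        · omega
    _ = _ := by field_simp

theorem lambertP_eq_latticeSum {k : ℕ} (hk : 3 ≤ k) {z : ℂ} (hz : 0 < z.im) :
    2 * Real.pi * I * (-riemannZeta k / 2 - lambertP k z) - riemannZeta (k + 1 : ℕ) / z =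
      ∑' x, latticeTerm k z x := by
  have hz0 : z ≠ 0 := fun h => by simp [h] at hz
  have h1 : ∀ n : ℕ, HasSum (fun m => latticeTerm k z (n, m)) (1 / ((n : ℂ) + 1) ^ k *
      (2 * Real.pi * I * (-1 / 2 - lambertKernel (((n : ℂ) + 1) * z)) -
        1 / (((n : ℂ) + 1) * z))) := by
    intro n
    have hn : 0 < (((n : ℂ) + 1) * z).im := by
      have := im_natCast_mul_pos n.succ_pos hz
      rwa [Nat.cast_succ] at this
    refine ((lambertKernel_hasSum hn).mul_left (1 / ((n : ℂ) + 1) ^ k)).congr_fun fun m => ?_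
    have hn0 : (n : ℂ) + 1 ≠ 0 := n.cast_add_one_ne_zero
    obtain ⟨l, rfl⟩ : ∃ l, k = l + 1 := ⟨k - 1, by omega⟩
    simp only [latticeTerm, Nat.add_sub_cancel]
    rw [pow_succ]
    field_simp
    ring
  have h2 := (summable_latticeTerm hk hz).hasSum.prod_fiberwise h1
  have h3 := (((hasSum_riemannZeta (k := k) (by omega)).mul_left (-1 / 2)).sub
    (hasSum_lambertP k hz)).mul_left (2 * Real.pi * I)
  have h4 := h3.sub ((hasSum_riemannZeta (k := k + 1) (by omega)).mul_left (1 / z))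
  refine Eq.trans ?_ (h4.unique (h2.congr_fun fun n => ?_))
  · ring
  · have hn0 : (n : ℂ) + 1 ≠ 0 := n.cast_add_one_ne_zero
    rw [pow_succ]
    field_simp

/-- The inverted term with swapped indices has the same denominator `(Nz)² - M²`. The difference
therefore has numerator proportional to `(Nz)^(2j) - M^(2j)`, and the quotient is a geometric sum.
-/
theorem latticeTerm_sub {j : ℕ} {z : ℂ} (hz : 0 < z.im) (n m : ℕ) :
    latticeTerm (2 * j + 1) z (n, m) - z ^ (2 * j) * latticeTerm (2 * j + 1) (-1 / z) (m, n) =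
      ∑ i ∈ Finset.range j, -2 * z ^ (2 * i + 1) *
        (1 / ((n : ℂ) + 1) ^ (2 * j - 2 * i) * (1 / ((m : ℂ) + 1) ^ (2 * i + 2))) := by
  have hz0 : z ≠ 0 := fun h => by simp [h] at hz
  have hn : (n : ℂ) + 1 ≠ 0 := n.cast_add_one_ne_zero
  have hm : (m : ℂ) + 1 ≠ 0 := m.cast_add_one_ne_zero
  have hd : (((n : ℂ) + 1) * z) ^ 2 - ((m : ℂ) + 1) ^ 2 ≠ 0 := by
    have h := le_norm_sq_sub_sq hz ((n : ℝ) + 1) ((m : ℝ) + 1)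
    push_cast at h
    have : 0 < ‖z‖ := norm_pos_iff.mpr hz0
    rw [← norm_pos_iff]
    exact lt_of_lt_of_le (by positivity) h
  simp only [latticeTerm, Nat.add_sub_cancel]
  generalize (n : ℂ) + 1 = N at *
  generalize (m : ℂ) + 1 = M at *
  have h1 : 2 * (-1 / z) / ((M * (-1 / z)) ^ 2 - N ^ 2) = 2 * z / ((N * z) ^ 2 - M ^ 2) := by
    have h2 : (M * (-1 / z)) ^ 2 - N ^ 2 = -((N * z) ^ 2 - M ^ 2) / z ^ 2 := by
      field_simp; ring
    rw [h2]
    field_simp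
  have hg := (Commute.all ((N * z) ^ 2) (M ^ 2)).geom_sum₂_mul j
  have h3 : ∀ i ∈ Finset.range j, -2 * z ^ (2 * i + 1) *
      (1 / N ^ (2 * j - 2 * i) * (1 / M ^ (2 * i + 2))) = -2 * z / (N ^ (2 * j) * M ^ (2 * j)) *
        (((N * z) ^ 2) ^ i * (M ^ 2) ^ (j - 1 - i)) := by
    intro i hi
    obtain ⟨l, rfl⟩ : ∃ l, j = i + 1 + l :=
      ⟨j - (i + 1), by have := Finset.mem_range.mp hi; omega⟩
    have e1 : 2 * (i + 1 + l) - 2 * i = 2 * l + 2 := by omega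
    have e2 : i + 1 + l - 1 - i = l := by omega
    rw [e1, e2]
    field_simp
    ring
  rw [Finset.sum_congr rfl h3, ← Finset.mul_sum, h1]
  have h4 : ∑ i ∈ Finset.range j, ((N * z) ^ 2) ^ i * (M ^ 2) ^ (j - 1 - i) =
      (((N * z) ^ 2) ^ j - (M ^ 2) ^ j) / ((N * z) ^ 2 - M ^ 2) := by
    rw [eq_div_iff hd, hg]
  rw [h4]
  have h5 : ((N * z) ^ 2) ^ j = N ^ (2 * j) * z ^ (2 * j) := by
    rw [← pow_mul, mul_pow]
  rw [h5, ← pow_mul]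
  field_simp
  ring

theorem riemannZeta_two_mul_eq (m : ℕ) :
    riemannZeta ((2 * m : ℕ) : ℂ) = -(2 * (Real.pi : ℂ) * I) ^ (2 * m) / 2 *
      ((bernoulli (2 * m) : ℂ) / ((2 * m).factorial : ℂ)) := by
  rcases Nat.eq_zero_or_pos m with rfl | hm
  · simp [riemannZeta_zero]
  · push_cast
    rw [riemannZeta_two_mul_nat hm.ne', mul_pow, mul_pow, pow_mul I, I_sq, pow_succ (-1 : ℂ)]
    obtain ⟨l, rfl⟩ : ∃ l, m = l + 1 := ⟨m - 1, by omega⟩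
    have : 2 * (l + 1) - 1 = 2 * l + 1 := by omega
    rw [this]
    field_simp
    ring

theorem im_neg_one_div_pos {z : ℂ} (hz : 0 < z.im) : 0 < (-1 / z).im := by
  have := UpperHalfPlane.im_inv_neg_coe_pos ⟨z, hz⟩
  rwa [← one_div, one_div_neg_eq_neg_one_div, ← neg_div] at this

theorem HasSum.mul_of_complex {f g : ℕ → ℂ} {s t : ℂ} (hf : HasSum f s) (hg : HasSum g t) :
    HasSum (fun x : ℕ × ℕ => f x.1 * g x.2) (s * t) :=
  hf.mul hg (summable_mul_of_summable_norm hf.summable.norm hg.summable.norm)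

theorem hasSum_riemannZeta_mul {a b : ℕ} (ha : 1 < a) (hb : 1 < b) :
    HasSum (fun x : ℕ × ℕ => 1 / ((x.1 : ℂ) + 1) ^ a * (1 / ((x.2 : ℂ) + 1) ^ b))
      (riemannZeta a * riemannZeta b) :=
  ((hasSum_riemannZeta ha).mul_of_complex (hasSum_riemannZeta hb)).congr_fun fun _ => rfl

theorem latticeSum_sub {j : ℕ} (hj : 1 ≤ j) {z : ℂ} (hz : 0 < z.im) :
    ∑' x, latticeTerm (2 * j + 1) z x - z ^ (2 * j) * ∑' x, latticeTerm (2 * j + 1) (-1 / z) x =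
      ∑ i ∈ Finset.range j, -2 * z ^ (2 * i + 1) *
        (riemannZeta (2 * j - 2 * i : ℕ) * riemannZeta (2 * i + 2 : ℕ)) := by
  have hk3 : 3 ≤ 2 * j + 1 := by omega
  have s1 := (summable_latticeTerm hk3 hz).hasSum
  have s2 := ((Equiv.prodComm ℕ ℕ).hasSum_iff.mpr
    (summable_latticeTerm hk3 (im_neg_one_div_pos hz)).hasSum).mul_left (z ^ (2 * j))
  have hz1 : ∀ i ∈ Finset.range j, HasSum (fun x : ℕ × ℕ => -2 * z ^ (2 * i + 1) *
      (1 / ((x.1 : ℂ) + 1) ^ (2 * j - 2 * i) * (1 / ((x.2 : ℂ) + 1) ^ (2 * i + 2))))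
      (-2 * z ^ (2 * i + 1) *
        (riemannZeta (2 * j - 2 * i : ℕ) * riemannZeta (2 * i + 2 : ℕ))) := by
    intro i hi
    have h := hasSum_riemannZeta_mul (a := 2 * j - 2 * i) (b := 2 * i + 2)
      (by have := Finset.mem_range.mp hi; omega) (by omega)
    exact h.mul_left (-2 * z ^ (2 * i + 1))
  refine (s1.sub s2).unique ((hasSum_sum hz1).congr_fun fun x => ?_)
  exact latticeTerm_sub hz x.1 x.2

/-- Ramanujan's formula: the modular transformation of the Lambert series. -/
theorem lambertP_sub {k : ℕ} (hk : Odd k) (hk1 : 1 < k) {z : ℂ} (hz : 0 < z.im) :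
    lambertP k z - z ^ (k - 1) * lambertP k (-1 / z) = corrR k z := by
  obtain ⟨j, rfl⟩ := hk
  have hz0 : z ≠ 0 := fun h => by simp [h] at hz
  have hk3 : 3 ≤ 2 * j + 1 := by omega
  have h1 := lambertP_eq_latticeSum hk3 hz
  have h2 := lambertP_eq_latticeSum hk3 (im_neg_one_div_pos hz)
  have h3 := latticeSum_sub (j := j) (by omega) hz
  rw [← h1, ← h2] at h3
  have hT : (2 * (Real.pi : ℂ) * I) ≠ 0 := two_pi_I_ne_zero
  have e1 : (2 * j + 1 + 1) / 2 + 1 = j + 1 + 1 := by omega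
  have e2 : ∀ m, 2 * j + 1 + 1 - 2 * m = 2 * (j + 1 - m) := fun m => by omega
  rw [corrR, e1]
  simp only [e2, Nat.add_sub_cancel]
  -- The extreme Bernoulli terms are split off: they come from the two `ζ(k+1)` terms of
  -- `lambertP_eq_latticeSum`, the inner ones from the products of zeta values.
  rw [Finset.sum_range_succ, Finset.sum_range_succ']
  have h4 : ∀ i ∈ Finset.range j, -2 * z ^ (2 * i + 1) *
      (riemannZeta (2 * j - 2 * i : ℕ) * riemannZeta (2 * i + 2 : ℕ)) =
      -(2 * (Real.pi : ℂ) * I) ^ (2 * j + 2) / (2 * z) *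
       (z ^ (2 * (i + 1)) * ((bernoulli (2 * (i + 1)) : ℂ) / ((2 * (i + 1)).factorial : ℂ)) *
        ((bernoulli (2 * (j + 1 - (i + 1))) : ℂ) /
          ((2 * (j + 1 - (i + 1))).factorial : ℂ))) := by
    intro i hi
    have e3 : 2 * j - 2 * i = 2 * (j + 1 - (i + 1)) := by omega
    have e4 : 2 * i + 2 = 2 * (i + 1) := by omega
    rw [e3, e4, riemannZeta_two_mul_eq, riemannZeta_two_mul_eq]
    have e5 : 2 * j + 2 = 2 * (j + 1 - (i + 1)) + 2 * (i + 1) := by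
      have := Finset.mem_range.mp hi; omega
    rw [e5, pow_add]
    field_simp
    ring
  rw [Finset.sum_congr rfl h4, ← Finset.mul_sum] at h3
  have e6 : 2 * j + 1 + 1 = 2 * (j + 1) := by omega
  rw [e6, riemannZeta_two_mul_eq] at h3
  simp only [Nat.sub_zero, Nat.sub_self, mul_zero, pow_zero, bernoulli_zero, Nat.factorial_zero]
  generalize ∑ i ∈ Finset.range j, (_ : ℂ) = S at *
  generalize 2 * (Real.pi : ℂ) * I = T at *
  simp only [Rat.cast_one, Nat.cast_one] at *
  field_simp at h3 ⊢
  apply mul_left_cancel₀ hT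
  linear_combination -h3

/-! ### The non-holomorphic derivative -/

/-- The function `P_k(z) - (z - z̄) P_k'(z) / (k - 1)`; it agrees with `derivT` on the imaginary
axis and, unlike `derivT`, it is periodic. -/
noncomputable def maassT (k : ℕ) (z : ℂ) : ℂ :=
  lambertP k z - (z - (starRingEnd ℂ) z) * deriv (lambertP k) z / ((k : ℂ) - 1)

/-- The function `R_k(z) - (z - z̄) R_k'(z) / (k - 1)`. -/
noncomputable def maassU (k : ℕ) (z : ℂ) : ℂ :=
  corrR k z - (z - (starRingEnd ℂ) z) * deriv (corrR k) z / ((k : ℂ) - 1)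

theorem derivT_eq_maassT (k : ℕ) {z : ℂ} (hz : z.re = 0) : derivT k z = maassT k z := by
  have h : z - (starRingEnd ℂ) z = 2 * z := by
    apply Complex.ext <;> simp [hz]; ring
  rw [derivT, maassT, h]

theorem natCast_sub_one_ne_zero {k : ℕ} (hk : 1 < k) : (k : ℂ) - 1 ≠ 0 :=
  sub_ne_zero.mpr (by exact_mod_cast hk.ne')

theorem hasDerivAt_lambertP (k : ℕ) {z : ℂ} (hz : 0 < z.im) :
    HasDerivAt (lambertP k) (deriv (lambertP k) z) z :=
  (differentiableAt_lambertP k hz).hasDerivAt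

theorem eventually_im_pos {z : ℂ} (hz : 0 < z.im) : ∀ᶠ w in nhds z, 0 < w.im :=
  (isOpen_lt continuous_const continuous_im).mem_nhds hz

/-- The derivative is read off from Ramanujan's formula rather than from the Bernoulli sum, so the
transformation laws below become algebraic identities. -/
theorem hasDerivAt_corrR {k : ℕ} (hk : Odd k) (hk1 : 1 < k) {z : ℂ} (hz : 0 < z.im) :
    HasDerivAt (corrR k) (deriv (lambertP k) z - (((k : ℂ) - 1) * z ^ (k - 2) *
      lambertP k (-1 / z) + z ^ (k - 1) * (deriv (lambertP k) (-1 / z) * (1 / z ^ 2)))) z := by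
  have hz0 : z ≠ 0 := fun h => by simp [h] at hz
  have h1 : HasDerivAt (fun w : ℂ => -1 / w) (1 / z ^ 2) z := by
    have := (hasDerivAt_inv hz0).neg
    refine (this.congr_deriv (by simp)).congr_of_eventuallyEq (Filter.Eventually.of_forall fun w => ?_)
    simp [neg_div]
  have h2 := (hasDerivAt_lambertP k (im_neg_one_div_pos hz)).comp z h1
  have h3 := (hasDerivAt_lambertP k hz).sub ((hasDerivAt_pow (k - 1) z).mul h2)
  refine (h3.congr_deriv ?_).congr_of_eventuallyEq ?_
  · have e : k - 1 - 1 = k - 2 := by omega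
    rw [e, Nat.cast_sub hk1.le, Nat.cast_one]
    rfl
  · filter_upwards [eventually_im_pos hz] with w hw
    rw [← lambertP_sub hk hk1 hw]
    rfl

theorem derivT_transform {k : ℕ} (hk : Odd k) (hk1 : 1 < k) {z : ℂ} (hz : 0 < z.im) :
    z ^ (k - 1) * derivT k (-1 / z) = derivU k z - derivT k z := by
  have hz0 : z ≠ 0 := fun h => by simp [h] at hz
  have hk0 := natCast_sub_one_ne_zero hk1
  rw [derivU, derivT, derivT, (hasDerivAt_corrR hk hk1 hz).deriv, ← lambertP_sub hk hk1 hz]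
  obtain ⟨l, rfl⟩ : ∃ l, k = l + 2 := ⟨k - 2, by omega⟩
  have e1 : l + 2 - 1 = l + 1 := rfl
  have e2 : l + 2 - 2 = l := rfl
  rw [e1, e2, pow_succ]
  generalize lambertP (l + 2) (-1 / z) = a
  generalize deriv (lambertP (l + 2)) (-1 / z) = b
  field_simp
  ring

/-- Apply the law of `derivT` at `z` and at `-1/z`; the two factors multiply to 1 because `k - 1` is
even. -/
theorem derivU_transform {k : ℕ} (hk : Odd k) (hk1 : 1 < k) {z : ℂ} (hz : 0 < z.im) :
    z ^ (k - 1) * derivU k (-1 / z) = derivU k z := by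
  have hz0 : z ≠ 0 := fun h => by simp [h] at hz
  have h1 := derivT_transform hk hk1 hz
  have h2 := derivT_transform hk hk1 (im_neg_one_div_pos hz)
  have h3 : -1 / (-1 / z) = z := by field_simp
  have h4 : z ^ (k - 1) * (-1 / z) ^ (k - 1) = 1 := by
    rw [← mul_pow, mul_div_cancel₀ _ hz0, Even.neg_one_pow]
    exact hk.tsub_odd odd_one
  rw [h3] at h2
  linear_combination derivT k z * h4 - z ^ (k - 1) * h2 + h1

/-- The coefficient of `P_k(-1/z)` is `-z^(k-1) + (z - z̄) z^(k-2) = -z̄ z^(k-2)`, and the term in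
`P_k'(-1/z)` carries the same factor. -/
theorem maassT_transform {k : ℕ} (hk : Odd k) (hk1 : 1 < k) {z : ℂ} (hz : 0 < z.im) :
    maassT k z - (starRingEnd ℂ) z * z ^ (k - 2) * maassT k (-1 / z) = maassU k z := by
  have hz0 : z ≠ 0 := fun h => by simp [h] at hz
  have hz1 : (starRingEnd ℂ) z ≠ 0 := by simpa using hz0
  have hk0 := natCast_sub_one_ne_zero hk1
  rw [maassU, maassT, maassT, (hasDerivAt_corrR hk hk1 hz).deriv, ← lambertP_sub hk hk1 hz,
    map_div₀, map_neg, map_one]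
  obtain ⟨l, rfl⟩ : ∃ l, k = l + 2 := ⟨k - 2, by omega⟩
  have e1 : l + 2 - 1 = l + 1 := rfl
  have e2 : l + 2 - 2 = l := rfl
  rw [e1, e2, pow_succ]
  generalize lambertP (l + 2) (-1 / z) = a
  generalize deriv (lambertP (l + 2)) (-1 / z) = b
  field_simp
  ring

theorem maassT_add_intCast (k : ℕ) (z : ℂ) (n : ℤ) : maassT k (z + n) = maassT k z := by
  have h : deriv (lambertP k) (z + n) = deriv (lambertP k) z := by
    rw [← deriv_comp_add_const]
    congr 1
    exact funext fun w => lambertP_add_intCast k w n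
  rw [maassT, maassT, h, lambertP_add_intCast, map_add, map_intCast, add_sub_add_right_eq_sub]

theorem maassT_neg_conj (k : ℕ) (z : ℂ) :
    maassT k (-(starRingEnd ℂ) z) = (starRingEnd ℂ) (maassT k z) := by
  have h : deriv (lambertP k) (-(starRingEnd ℂ) z) = -(starRingEnd ℂ) (deriv (lambertP k) z) := by
    have h1 : lambertP k = fun w => ((starRingEnd ℂ) ∘ lambertP k ∘ (starRingEnd ℂ)) (-w) := by
      funext w
      have := lambertP_neg_conj k ((starRingEnd ℂ) (-w))
      simpa using this
    conv_lhs => rw [h1]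
    rw [deriv_comp_neg, deriv_conj_conj]
    simp
  rw [maassT, maassT, h, lambertP_neg_conj]
  simp
  ring

theorem deriv_lambertP_hecke (k : ℕ) {p : ℕ} (hp : p.Prime) {z : ℂ} (hz : 0 < z.im) :
    ∑ j ∈ Finset.range p, deriv (lambertP k) ((z + j) / p) * (1 / p) =
      p * deriv (lambertP k) z + (1 / (p : ℂ) ^ k) *
        (p * deriv (lambertP k) z - p * (deriv (lambertP k) (p * z) * p)) := by
  have h1 : HasDerivAt (fun w : ℂ => ∑ j ∈ Finset.range p, lambertP k ((w + j) / p))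
      (∑ j ∈ Finset.range p, deriv (lambertP k) ((z + j) / p) * (1 / p)) z := by
    refine HasDerivAt.fun_sum fun j _ => ?_
    exact HasDerivAt.comp (h₂ := lambertP k) (h := fun w : ℂ => (w + j) / p) z
      (hasDerivAt_lambertP k (im_add_natCast_div_pos hp.pos hz j))
      (((hasDerivAt_id z).add_const (j : ℂ)).div_const (p : ℂ))
  have h2 : HasDerivAt (fun w : ℂ => lambertP k (p * w)) (deriv (lambertP k) (p * z) * p) z := by
    have := (hasDerivAt_lambertP k (im_natCast_mul_pos hp.pos hz)).comp z
      ((hasDerivAt_id z).const_mul (p : ℂ))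
    rw [mul_one] at this
    exact this
  have h3 := ((hasDerivAt_lambertP k hz).const_mul (p : ℂ)).add
    ((((hasDerivAt_lambertP k hz).const_mul (p : ℂ)).sub (h2.const_mul (p : ℂ))).const_mul
      (1 / (p : ℂ) ^ k))
  refine h1.unique (h3.congr_of_eventuallyEq ?_)
  filter_upwards [eventually_im_pos hz] with w hw
  exact lambertP_hecke k hp hw

/-- The chain-rule factors `1/p` and `p` are exactly the scalings of `z - z̄` at `(z + j)/p` and at
`pz`, so the relation for `P_k` passes to `maassT` unchanged. -/
theorem maassT_hecke (k : ℕ) {p : ℕ} (hp : p.Prime) {z : ℂ} (hz : 0 < z.im) :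
    ∑ j ∈ Finset.range p, maassT k ((z + j) / p) =
      p * maassT k z + (1 / (p : ℂ) ^ k) * (p * maassT k z - p * maassT k (p * z)) := by
  have h1 := lambertP_hecke k hp hz
  have h2 := deriv_lambertP_hecke k hp hz
  have h3 : ∀ j ∈ Finset.range p, maassT k ((z + j) / p) = lambertP k ((z + j) / p) -
      (z - (starRingEnd ℂ) z) / ((k : ℂ) - 1) * (deriv (lambertP k) ((z + j) / p) * (1 / p)) := by
    intro j _
    rw [maassT, map_div₀, map_add, conj_natCast, conj_natCast]
    ring
  rw [Finset.sum_congr rfl h3, Finset.sum_sub_distrib, ← Finset.mul_sum, h1, h2, maassT, maassT,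
    map_mul, conj_natCast]
  ring

/-! ### The correction term -/

/-- The `m`-th coefficient of the Bernoulli sum in `corrR`. -/
def bernoulliCoeff (k m : ℕ) : ℚ :=
  bernoulli (2 * m) / (2 * m).factorial * (bernoulli (k + 1 - 2 * m) / (k + 1 - 2 * m).factorial)

/-- The Bernoulli sum in `maassU`, without the power of `π`. -/
noncomputable def bernoulliSum (k : ℕ) (z : ℂ) : ℂ :=
  ∑ m ∈ Finset.range ((k + 1) / 2 + 1), (bernoulliCoeff k m : ℂ) * (z ^ (2 * m) * z⁻¹ -
    (z - (starRingEnd ℂ) z) * ((2 * m - 1) * z ^ (2 * m) * (z⁻¹) ^ 2) / ((k : ℂ) - 1))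

theorem maassU_eq {k : ℕ} (hk1 : 1 < k) {z : ℂ} (hz : z ≠ 0) :
    maassU k z = riemannZeta k / 2 * ((starRingEnd ℂ) z * z ^ (k - 2) - 1) +
      (2 * (Real.pi : ℂ) * I) ^ k / 2 * bernoulliSum k z := by
  have hk0 := natCast_sub_one_ne_zero hk1
  have h1 : corrR k = fun w => riemannZeta k / 2 * (w ^ (k - 1) - 1) +
      (2 * (Real.pi : ℂ) * I) ^ k / 2 * ∑ m ∈ Finset.range ((k + 1) / 2 + 1),
        (bernoulliCoeff k m : ℂ) * (w ^ (2 * m) * w⁻¹) := by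
    funext w
    rw [corrR]
    congr 1
    · ring
    · rw [← div_div, div_eq_mul_inv _ w, mul_assoc, Finset.mul_sum]
      congr 1
      refine Finset.sum_congr rfl fun m _ => ?_
      rw [bernoulliCoeff]
      push_cast
      ring
  have h2 : ∀ m : ℕ, HasDerivAt (fun w : ℂ => w ^ (2 * m) * w⁻¹)
      ((2 * m - 1) * z ^ (2 * m) * (z⁻¹) ^ 2) z := by
    intro m
    refine ((hasDerivAt_pow (2 * m) z).mul (hasDerivAt_inv hz)).congr_deriv ?_
    rcases m with _ | m
    · simp
    · have : 2 * (m + 1) - 1 = 2 * m + 1 := by omega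
      rw [this]
      push_cast
      field_simp
      ring
  have h3 : HasDerivAt (corrR k) (riemannZeta k / 2 * (((k : ℂ) - 1) * z ^ (k - 2)) +
      (2 * (Real.pi : ℂ) * I) ^ k / 2 * ∑ m ∈ Finset.range ((k + 1) / 2 + 1),
        (bernoulliCoeff k m : ℂ) * ((2 * m - 1) * z ^ (2 * m) * (z⁻¹) ^ 2)) z := by
    rw [h1]
    refine HasDerivAt.add (HasDerivAt.const_mul _ ?_) (HasDerivAt.const_mul _
      (HasDerivAt.fun_sum fun m _ => (h2 m).const_mul _))
    refine ((hasDerivAt_pow (k - 1) z).sub_const 1).congr_deriv ?_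
    have e : k - 1 - 1 = k - 2 := by omega
    rw [e, Nat.cast_sub hk1.le, Nat.cast_one]
  have h4 : bernoulliSum k z = ∑ m ∈ Finset.range ((k + 1) / 2 + 1),
        (bernoulliCoeff k m : ℂ) * (z ^ (2 * m) * z⁻¹) -
      (z - (starRingEnd ℂ) z) / ((k : ℂ) - 1) * ∑ m ∈ Finset.range ((k + 1) / 2 + 1),
        (bernoulliCoeff k m : ℂ) * ((2 * m - 1) * z ^ (2 * m) * (z⁻¹) ^ 2) := by
    rw [bernoulliSum, Finset.mul_sum, ← Finset.sum_sub_distrib]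
    refine Finset.sum_congr rfl fun m _ => ?_
    ring
  rw [maassU, h3.deriv, h4, h1]
  have e : z ^ (k - 1) = z ^ (k - 2) * z := by
    rw [← pow_succ]; congr 1; omega
  simp only [e]
  generalize ∑ m ∈ Finset.range ((k + 1) / 2 + 1), (_ : ℂ) = S
  generalize ∑ m ∈ Finset.range ((k + 1) / 2 + 1), (_ : ℂ) = S'
  field_simp
  ring

/-! ### Imaginary quadratic points -/

theorem sqrtNeg_mul_self (s : ℕ) : sqrtNeg s * sqrtNeg s = -s := by
  rw [sqrtNeg, mul_mul_mul_comm, I_mul_I, ← ofReal_mul, Real.mul_self_sqrt s.cast_nonneg]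
  simp

/-- The field `ℚ(√-s)` as a subfield of `ℂ`. -/
noncomputable def quadField (s : ℕ) : Subfield ℂ where
  carrier := {z | ∃ a b : ℚ, z = a + b * sqrtNeg s}
  zero_mem' := ⟨0, 0, by simp⟩
  one_mem' := ⟨1, 0, by simp⟩
  add_mem' := by
    rintro _ _ ⟨a, b, rfl⟩ ⟨c, d, rfl⟩
    exact ⟨a + c, b + d, by push_cast; ring⟩
  neg_mem' := by
    rintro _ ⟨a, b, rfl⟩
    exact ⟨-a, -b, by push_cast; ring⟩
  mul_mem' := by
    rintro _ _ ⟨a, b, rfl⟩ ⟨c, d, rfl⟩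
    refine ⟨a * c - s * (b * d), a * d + b * c, ?_⟩
    push_cast
    linear_combination (b : ℂ) * d * sqrtNeg_mul_self s
  inv_mem' := by
    rintro _ ⟨a, b, rfl⟩
    have h1 : (starRingEnd ℂ) ((a : ℂ) + b * sqrtNeg s) = a - b * sqrtNeg s := by
      simp [sqrtNeg, sub_eq_add_neg]
    have h2 : normSq ((a : ℂ) + b * sqrtNeg s) = ((a ^ 2 + s * b ^ 2 : ℚ) : ℝ) := by
      rw [normSq_apply]
      simp only [sqrtNeg, add_re, mul_re, add_im, mul_im, ratCast_re, ratCast_im, ofReal_re,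
        ofReal_im, I_re, I_im]
      push_cast
      linear_combination (b : ℝ) ^ 2 * Real.mul_self_sqrt (s.cast_nonneg (α := ℝ))
    refine ⟨a / (a ^ 2 + s * b ^ 2), -b / (a ^ 2 + s * b ^ 2), ?_⟩
    rw [inv_def, h1, h2]
    push_cast
    ring

theorem conj_mem_quadField {s : ℕ} {z : ℂ} (hz : z ∈ quadField s) :
    (starRingEnd ℂ) z ∈ quadField s := by
  obtain ⟨a, b, rfl⟩ := hz
  exact ⟨a, -b, by simp [sqrtNeg]⟩

theorem bernoulliSum_mem_quadField {s k : ℕ} {z : ℂ} (hz : z ∈ quadField s) :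
    bernoulliSum k z ∈ quadField s := by
  refine sum_mem fun m _ => mul_mem (SubfieldClass.ratCast_mem _ _) (sub_mem
    (mul_mem (pow_mem hz _) (inv_mem hz)) (div_mem (mul_mem (sub_mem hz (conj_mem_quadField hz))
      (mul_mem (mul_mem (sub_mem (mul_mem (ofNat_mem _ 2) (natCast_mem _ m)) (one_mem _))
        (pow_mem hz _)) (pow_mem (inv_mem hz) _))) (sub_mem (natCast_mem _ k) (one_mem _))))

/-- The point `x + y √-s`. -/
noncomputable def quadPoint (s : ℕ) (x y : ℚ) : ℂ := x + y * sqrtNeg s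

theorem quadPoint_re (s : ℕ) (x y : ℚ) : (quadPoint s x y).re = x := by
  simp [quadPoint, sqrtNeg]

theorem quadPoint_im (s : ℕ) (x y : ℚ) : (quadPoint s x y).im = y * √s := by
  simp [quadPoint, sqrtNeg]

theorem quadPoint_im_pos {s : ℕ} (hs : 0 < s) (x : ℚ) {y : ℚ} (hy : 0 < y) :
    0 < (quadPoint s x y).im := by
  rw [quadPoint_im]
  have : (0 : ℝ) < y := by exact_mod_cast hy
  positivity

theorem conj_quadPoint (s : ℕ) (x y : ℚ) :
    (starRingEnd ℂ) (quadPoint s x y) = quadPoint s x (-y) := by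
  simp [quadPoint, sqrtNeg]

theorem quadPoint_mul (s : ℕ) (x y u v : ℚ) :
    quadPoint s x y * quadPoint s u v = quadPoint s (x * u - s * (y * v)) (x * v + y * u) := by
  simp only [quadPoint]
  push_cast
  linear_combination (y : ℂ) * v * sqrtNeg_mul_self s

theorem quadPoint_zero_right (s : ℕ) (x : ℚ) : quadPoint s x 0 = x := by simp [quadPoint]

theorem norm_quadPoint_sq (s : ℕ) (x y : ℚ) :
    ‖quadPoint s x y‖ ^ 2 = ((x ^ 2 + s * y ^ 2 : ℚ) : ℝ) := by
  rw [← normSq_eq_norm_sq, normSq_apply, quadPoint_re, quadPoint_im]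
  push_cast
  linear_combination (y : ℝ) ^ 2 * Real.mul_self_sqrt (s.cast_nonneg (α := ℝ))

theorem neg_one_div_quadPoint {s : ℕ} {x y : ℚ} (h : x ^ 2 + s * y ^ 2 ≠ 0) :
    -1 / quadPoint s x y = quadPoint s (-x / (x ^ 2 + s * y ^ 2)) (y / (x ^ 2 + s * y ^ 2)) := by
  have h1 : quadPoint s x y ≠ 0 := by
    intro h0
    have := norm_quadPoint_sq s x y
    rw [h0, norm_zero, zero_pow two_ne_zero] at this
    exact h (by exact_mod_cast this.symm)
  rw [div_eq_iff h1, quadPoint_mul]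
  have e1 : -x / (x ^ 2 + s * y ^ 2) * x - s * (y / (x ^ 2 + s * y ^ 2) * y) = -1 := by
    field_simp; ring
  have e2 : -x / (x ^ 2 + s * y ^ 2) * y + y / (x ^ 2 + s * y ^ 2) * x = 0 := by
    field_simp; ring
  rw [e1, e2, quadPoint_zero_right]
  simp

/-! ### Real values and rational inversion coefficients at quadratic points -/

/-- The real part of `maassT` at `x + y √-s`. -/
noncomputable def reT (k s : ℕ) (x y : ℚ) : ℝ := (maassT k (quadPoint s x y)).re

theorem reT_add_intCast (k s : ℕ) (x y : ℚ) (n : ℤ) : reT k s (x + n) y = reT k s x y := by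
  have h : quadPoint s (x + n) y = quadPoint s x y + n := by
    simp only [quadPoint]; push_cast; ring
  rw [reT, h, maassT_add_intCast, reT]

theorem reT_neg (k s : ℕ) (x y : ℚ) : reT k s (-x) y = reT k s x y := by
  have h : quadPoint s (-x) y = -(starRingEnd ℂ) (quadPoint s x y) := by
    rw [conj_quadPoint]; simp [quadPoint]; ring
  rw [reT, h, maassT_neg_conj, conj_re, reT]

/-- When `2x` is an integer, `-z̄` is an integer translate of `z`, so the value equals its own
conjugate. -/
theorem maassT_quadPoint_im {k s : ℕ} {x : ℚ} (y : ℚ) {n : ℤ} (hx : 2 * x = n) :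
    (maassT k (quadPoint s x y)).im = 0 := by
  have h : -(starRingEnd ℂ) (quadPoint s x y) = quadPoint s x y + ((-n : ℤ) : ℂ) := by
    rw [conj_quadPoint]
    simp only [quadPoint]
    have : (n : ℂ) = 2 * x := by exact_mod_cast hx.symm
    push_cast
    rw [this]
    ring
  have h1 := maassT_neg_conj k (quadPoint s x y)
  rw [h, maassT_add_intCast] at h1
  exact conj_eq_iff_im.mp h1.symm

theorem reT_hecke (k : ℕ) {p : ℕ} (hp : p.Prime) {s : ℕ} (hs : 0 < s) (x : ℚ) {y : ℚ}
    (hy : 0 < y) :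
    ∑ j ∈ Finset.range p, reT k s ((x + j) / p) (y / p) = p * reT k s x y +
      ((1 / (p : ℚ) ^ k : ℚ) : ℝ) * (p * reT k s x y - p * reT k s (p * x) (p * y)) := by
  have h := congrArg re (maassT_hecke k hp (quadPoint_im_pos hs x hy))
  have h1 : ∀ j : ℕ, (quadPoint s x y + j) / p = quadPoint s ((x + j) / p) (y / p) := by
    intro j; simp only [quadPoint]; push_cast; ring
  have h2 : p * quadPoint s x y = quadPoint s (p * x) (p * y) := by
    simp only [quadPoint]; push_cast; ring
  have h3 : (1 / (p : ℂ) ^ k) = (((1 / (p : ℚ) ^ k : ℚ) : ℝ) : ℂ) := by push_cast; rfl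
  rw [h2, h3, re_sum] at h
  simp only [h1] at h
  rw [add_re, re_ofReal_mul, sub_re, ← ofReal_natCast p, re_ofReal_mul, re_ofReal_mul] at h
  exact h

/-- The value `ζ(k)` as a real number. -/
noncomputable def zetaReal (k : ℕ) : ℝ := (riemannZeta k).re

theorem ofReal_zetaReal {k : ℕ} (hk : 1 < k) : (zetaReal k : ℂ) = riemannZeta k := by
  have h : (starRingEnd ℂ) (riemannZeta k) = riemannZeta k := by
    rw [zeta_nat_eq_tsum_of_gt_one hk, conj_tsum]
    simp
  exact conj_eq_iff_re.mp h

theorem maassT_neg_one_div {k : ℕ} (hk : Odd k) (hk1 : 1 < k) {z w : ℂ} (hz : 0 < z.im)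
    (hw : w = (starRingEnd ℂ) z * z ^ (k - 2)) :
    maassT k (-1 / z) = 1 / w * maassT k z - (zetaReal k / 2 : ℝ) * (1 - 1 / w) -
      (2 * (Real.pi : ℂ) * I) ^ k / 2 * (bernoulliSum k z * (1 / w)) := by
  have hz0 : z ≠ 0 := fun h => by simp [h] at hz
  have hw0 : w ≠ 0 := by
    rw [hw]; exact mul_ne_zero (by simpa using hz0) (pow_ne_zero _ hz0)
  have h1 := maassT_transform hk hk1 hz
  rw [maassU_eq hk1 hz0, ← hw, ← ofReal_zetaReal hk1] at h1
  generalize maassT k (-1 / z) = a at *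
  push_cast
  field_simp
  linear_combination (-2) * h1

/-- For odd `k` the power `(2πi)^k` is purely imaginary, so only the `√-s` component of `w`
survives. -/
theorem re_two_pi_I_pow_mul {k s : ℕ} (hk : Odd k) {w : ℂ} (hw : w ∈ quadField s) :
    ∃ q : ℚ, ((2 * (Real.pi : ℂ) * I) ^ k / 2 * w).re = q * (√s * Real.pi ^ k) := by
  obtain ⟨j, rfl⟩ := hk
  obtain ⟨a, b, rfl⟩ := hw
  refine ⟨-(2 ^ (2 * j) * (-1) ^ j * b), ?_⟩
  have h : (2 * (Real.pi : ℂ) * I) ^ (2 * j + 1) / 2 * (a + b * sqrtNeg s) =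
      ((-(2 ^ (2 * j) * (-1) ^ j * b) * (√s * Real.pi ^ (2 * j + 1)) : ℝ) : ℂ) +
      ((2 ^ (2 * j) * (-1) ^ j * a * Real.pi ^ (2 * j + 1) : ℝ) : ℂ) * I := by
    rw [mul_pow, mul_pow, pow_succ I, pow_mul I, I_sq, pow_succ (2 : ℂ), sqrtNeg]
    push_cast
    linear_combination (2 ^ (2 * j) * (-1) ^ j * b * (√s * Real.pi ^ (2 * j + 1)) : ℂ) * I_mul_I
  rw [h, add_re, ofReal_re, re_ofReal_mul, I_re]
  push_cast
  ring

/-- Reality of `maassT` at `z` is what gives `Re((1/w) T) = Re(1/w) T`; here `w = z̄ z^(k-2) = |z|²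
z^(k-3)` lies in the quadratic field, so `Re(1/w)` is rational. -/
theorem reT_neg_one_div {k : ℕ} (hk : Odd k) (hk1 : 1 < k) {s : ℕ} (hs : 0 < s) {x y : ℚ}
    (hy : 0 < y) {n : ℤ} (hx : 2 * x = n) :
    ∃ ρ q : ℚ, (ρ : ℝ) =
        (1 / (((x ^ 2 + s * y ^ 2 : ℚ) : ℂ) * quadPoint s x y ^ (k - 3))).re ∧
      reT k s (-x / (x ^ 2 + s * y ^ 2)) (y / (x ^ 2 + s * y ^ 2)) =
        ρ * reT k s x y - zetaReal k / 2 * (1 - ρ) - q * (√s * Real.pi ^ k) := by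
  have hN : x ^ 2 + s * y ^ 2 ≠ 0 := by positivity
  set z := quadPoint s x y with hz
  set w : ℂ := ((x ^ 2 + s * y ^ 2 : ℚ) : ℂ) * z ^ (k - 3) with hw
  have hk3 : k - 2 = k - 3 + 1 := by obtain ⟨j, rfl⟩ := hk; omega
  have hw1 : w = (starRingEnd ℂ) z * z ^ (k - 2) := by
    rw [hw, hk3, pow_succ' z, ← mul_assoc, hz, conj_quadPoint, quadPoint_mul]
    have e1 : x * x - s * (-y * y) = x ^ 2 + s * y ^ 2 := by ring
    have e2 : x * y + -y * x = 0 := by ring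
    rw [e1, e2, quadPoint_zero_right]
  have hzm : z ∈ quadField s := ⟨x, y, rfl⟩
  have hwm : 1 / w ∈ quadField s :=
    div_mem (one_mem _) (mul_mem (SubfieldClass.ratCast_mem _ _) (pow_mem hzm _))
  obtain ⟨q, hq⟩ := re_two_pi_I_pow_mul hk (mul_mem (bernoulliSum_mem_quadField (k := k) hzm) hwm)
  obtain ⟨ρ, b, hρ⟩ := hwm
  have hρ' : (ρ : ℝ) = (1 / w).re := by rw [hρ]; exact (quadPoint_re s ρ b).symm
  refine ⟨ρ, q, hρ', ?_⟩
  have h := congrArg re (maassT_neg_one_div hk hk1 (quadPoint_im_pos hs x hy) hw1)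
  rw [sub_re, sub_re, hq, mul_re, maassT_quadPoint_im y hx, mul_zero, sub_zero, re_ofReal_mul,
    sub_re, one_re, ← hρ', neg_one_div_quadPoint hN] at h
  exact h

/-- With `k - 3 = l m` and `z^l` rational, the coefficient `ρ` has a closed form. -/
theorem reT_neg_one_div_of_pow {l m : ℕ} (hl : Even l) {s : ℕ} (hs : 0 < s) {x y : ℚ}
    (hy : 0 < y) {n : ℤ} (hx : 2 * x = n) {r : ℚ} (hr : quadPoint s x y ^ l = r) {N x' y' : ℚ}
    (hN : x ^ 2 + s * y ^ 2 = N) (hx' : -x / N = x') (hy' : y / N = y') :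
    ∃ q : ℚ, reT (l * m + 3) s x' y' = ((1 / (N * r ^ m) : ℚ) : ℝ) * reT (l * m + 3) s x y -
      zetaReal (l * m + 3) / 2 * (1 - ((1 / (N * r ^ m) : ℚ) : ℝ)) -
      q * (√s * Real.pi ^ (l * m + 3)) := by
  subst hN hx' hy'
  have hk : Odd (l * m + 3) := (hl.mul_right m).add_odd (by decide)
  obtain ⟨ρ, q, hρ, h⟩ := reT_neg_one_div hk (by omega) hs hy hx
  have : ρ = 1 / ((x ^ 2 + s * y ^ 2) * r ^ m) := by
    rw [Nat.add_sub_cancel, pow_mul, hr] at hρ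
    have e : (1 / (((x ^ 2 + s * y ^ 2 : ℚ) : ℂ) * (r : ℂ) ^ m)) =
        ((1 / ((x ^ 2 + s * y ^ 2) * r ^ m) : ℚ) : ℂ) := by push_cast; rfl
    rw [e, ratCast_re] at hρ
    exact_mod_cast hρ
  rw [← this]
  exact ⟨q, h⟩

theorem reT_neg_one_div_le {k : ℕ} (hk : Odd k) (hk1 : 1 < k) {s : ℕ} (hs : 0 < s) {x y : ℚ}
    (hy : 0 < y) {n : ℤ} (hx : 2 * x = n) :
    ∃ ρ q : ℚ, |ρ| ≤ (1 / (x ^ 2 + s * y ^ 2)) ^ ((k - 1) / 2) ∧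
      reT k s (-x / (x ^ 2 + s * y ^ 2)) (y / (x ^ 2 + s * y ^ 2)) =
        ρ * reT k s x y - zetaReal k / 2 * (1 - ρ) - q * (√s * Real.pi ^ k) := by
  obtain ⟨ρ, q, hρ, h⟩ := reT_neg_one_div hk hk1 hs hy hx
  refine ⟨ρ, q, ?_, h⟩
  obtain ⟨j, rfl⟩ : ∃ j, k = 2 * j + 3 := by
    obtain ⟨j, rfl⟩ := hk; exact ⟨j - 1, by omega⟩
  have h1 := abs_re_le_norm (1 / (((x ^ 2 + s * y ^ 2 : ℚ) : ℂ) * quadPoint s x y ^ (2 * j)))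
  rw [Nat.add_sub_cancel] at hρ
  have hN : (0 : ℝ) ≤ ((x ^ 2 + s * y ^ 2 : ℚ) : ℝ) := by
    have : 0 ≤ x ^ 2 + s * y ^ 2 := by positivity
    exact_mod_cast this
  rw [← hρ, norm_div, norm_one, norm_mul, norm_pow, pow_mul, norm_quadPoint_sq,
    ← ofReal_ratCast, norm_real, Real.norm_of_nonneg hN, ← pow_succ'] at h1
  have e : (2 * j + 3 - 1) / 2 = j + 1 := by omega
  rw [e, one_div_pow]
  exact_mod_cast h1

/-! ### Explicit inversion constants at `k = 3` -/

theorem bernoulliSum_three (z : ℂ) (hz : z ≠ 0) : bernoulliSum 3 z = -1 / 720 *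
    (1 / z - 5 * z + z ^ 3 - (z - (starRingEnd ℂ) z) / 2 * (-1 / z ^ 2 - 5 + 3 * z ^ 2)) := by
  have h4 : bernoulli 4 = -1 / 30 := by
    rw [bernoulli_eq_bernoulli'_of_ne_one (by decide)]; exact bernoulli'_four
  have h2 : bernoulli 2 = 6⁻¹ := bernoulli_two
  simp only [bernoulliSum, Finset.sum_range_succ, Finset.sum_range_zero, bernoulliCoeff]
  norm_num [h2, h4, Nat.factorial]
  field_simp
  ring

/-- Meant for `n = 1/|z|²`, where `1/z = n z̄`. Keeping `n` free makes this a polynomial identity.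
-/
theorem im_bernoulliSum_three (X Y n : ℝ) :
    (n * (X - Y * I) - 5 * (X + Y * I) + (X + Y * I) ^ 3 -
      Y * I * (-(n * (X - Y * I)) ^ 2 - 5 + 3 * (X + Y * I) ^ 2) : ℂ).im =
      -n * Y + n ^ 2 * Y * (X ^ 2 - Y ^ 2) + 2 * Y ^ 3 := by
  simp [pow_succ]
  ring

/-- At `k = 3` the factor `w = |z|²` is itself rational, so integrality of `2x` is not needed. -/
theorem reT_three_neg_one_div {s : ℕ} (hs : 0 < s) (x : ℚ) {y : ℚ} (hy : 0 < y) {N x' y' : ℚ}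
    (hN : x ^ 2 + s * y ^ 2 = N) (hx' : -x / N = x') (hy' : y / N = y') :
    reT 3 s x' y' = ((1 / N : ℚ) : ℝ) * reT 3 s x y -
      zetaReal 3 / 2 * (1 - ((1 / N : ℚ) : ℝ)) +
      ((s * y ^ 3 / 90 * (1 - 1 / N ^ 2) / N : ℚ) : ℝ) * (√s * Real.pi ^ 3) := by
  subst hN hx' hy'
  have hN : x ^ 2 + s * y ^ 2 ≠ 0 := by positivity
  have hN' : (x : ℂ) ^ 2 + s * (y : ℂ) ^ 2 ≠ 0 := by exact_mod_cast hN
  set z := quadPoint s x y with hz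
  have him : 0 < z.im := quadPoint_im_pos hs x hy
  have hz0 : z ≠ 0 := fun h => by simp [h] at him
  have hw : ((x ^ 2 + s * y ^ 2 : ℚ) : ℂ) = (starRingEnd ℂ) z * z ^ (3 - 2) := by
    rw [pow_one, hz, conj_quadPoint, quadPoint_mul]
    have e1 : x * x - s * (-y * y) = x ^ 2 + s * y ^ 2 := by ring
    have e2 : x * y + -y * x = 0 := by ring
    rw [e1, e2, quadPoint_zero_right]
  have h := maassT_neg_one_div (by decide) (by norm_num) him hw
  rw [bernoulliSum_three z hz0] at h
  have hinv : 1 / z = ((1 / (x ^ 2 + s * y ^ 2) : ℚ) : ℂ) * (starRingEnd ℂ) z := by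
    push_cast
    push_cast at hw
    have hz1 : (starRingEnd ℂ) z ≠ 0 := by simpa using hz0
    rw [hw]
    field_simp
  have hinv2 : -1 / z ^ 2 = -(1 / z) ^ 2 := by ring
  rw [hinv2, hinv, neg_one_div_quadPoint hN] at h
  have hx : z = (x : ℝ) + (y * √s : ℝ) * I := by
    rw [hz, quadPoint, sqrtNeg]; push_cast; ring
  have hc : (starRingEnd ℂ) z = (x : ℝ) - (y * √s : ℝ) * I := by
    rw [hz, conj_quadPoint, quadPoint, sqrtNeg]; push_cast; ring
  have hd : (z - (starRingEnd ℂ) z) / 2 = (y * √s : ℝ) * I := by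
    rw [hc, hx]; ring
  have hp : (2 * (Real.pi : ℂ) * I) ^ 3 / 2 = ((-4 * Real.pi ^ 3 : ℝ) : ℂ) * I := by
    push_cast
    linear_combination 4 * (Real.pi : ℂ) ^ 3 * I * I_sq
  have hG := im_bernoulliSum_three x (y * √s) ((1 / (x ^ 2 + s * y ^ 2) : ℚ) : ℝ)
  rw [← hx, ← hc, ofReal_ratCast, ← hd] at hG
  generalize hg : ((1 / (x ^ 2 + s * y ^ 2) : ℚ) : ℂ) * (starRingEnd ℂ) z - 5 * z + z ^ 3 -
    (z - (starRingEnd ℂ) z) / 2 *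
      (-(((1 / (x ^ 2 + s * y ^ 2) : ℚ) : ℂ) * (starRingEnd ℂ) z) ^ 2 - 5 + 3 * z ^ 2) = G at *
  have hn : (1 / ((x ^ 2 + s * y ^ 2 : ℚ) : ℂ)) = ((1 / (x ^ 2 + s * y ^ 2) : ℚ) : ℂ) := by
    push_cast; rfl
  have hw3 : ((-4 * Real.pi ^ 3 : ℝ) : ℂ) * I * (-1 / 720 * G *
      ((1 / (x ^ 2 + s * y ^ 2) : ℚ) : ℂ)) =
      ((Real.pi ^ 3 / 180 * ((1 / (x ^ 2 + s * y ^ 2) : ℚ) : ℝ) : ℝ) : ℂ) * (I * G) := by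
    push_cast; ring
  have h2 := congrArg re h
  rw [hp, hn, hw3, ← ofReal_ratCast (1 / (x ^ 2 + s * y ^ 2)), sub_re, sub_re, re_ofReal_mul,
    re_ofReal_mul, re_ofReal_mul, I_mul_re, hG, ← ofReal_one, ← ofReal_sub, ofReal_re] at h2
  refine h2.trans ?_
  have hs2 := Real.sq_sqrt (s.cast_nonneg (α := ℝ))
  have hN2 : (x : ℝ) ^ 2 + s * (y : ℝ) ^ 2 ≠ 0 := by exact_mod_cast hN
  have hq : ((y : ℝ) * √s) ^ 2 = s * (y : ℝ) ^ 2 := by rw [mul_pow, hs2]; ring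
  rw [reT, pow_succ ((y : ℝ) * √s) 2, hq]
  push_cast
  field_simp
  ring

/-! ### Rational combinations -/

/-- The rational span of `√s π^k` and the values `T_k(d √-s / 2)`, `d ∈ D`. -/
noncomputable def valueSpan (k s : ℕ) (D : Finset ℕ) : Submodule ℚ ℝ :=
  Submodule.span ℚ (insert (√s * Real.pi ^ k) ((fun d : ℕ => reT k s 0 (d / 2)) '' D))

theorem ratCast_mul_mem {M : Submodule ℚ ℝ} {x : ℝ} (q : ℚ) (hx : x ∈ M) : (q : ℝ) * x ∈ M := by
  rw [← Rat.smul_def]; exact M.smul_mem q hx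

theorem sqrt_mul_pi_pow_mem (k s : ℕ) (D : Finset ℕ) : √s * Real.pi ^ k ∈ valueSpan k s D :=
  Submodule.subset_span (Set.mem_insert _ _)

theorem reT_mem_valueSpan {k s : ℕ} {D : Finset ℕ} {y : ℚ} (d : ℕ) (hd : d ∈ D)
    (hy : y = d / 2) : reT k s 0 y ∈ valueSpan k s D :=
  Submodule.subset_span (Set.mem_insert_of_mem _ ⟨d, hd, by rw [hy]⟩)

/-- Cramer's rule modulo `M`, with `x` the unwanted value. -/
theorem mem_of_eliminate {M : Submodule ℚ ℝ} {α β γ δ : ℚ} {x ζ : ℝ} (h : α * δ - γ * β ≠ 0)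
    (h1 : α * x + β * ζ ∈ M) (h2 : γ * x + δ * ζ ∈ M) : ζ ∈ M := by
  have h3 := ratCast_mul_mem (α * δ - γ * β)⁻¹
    (M.sub_mem (ratCast_mul_mem α h2) (ratCast_mul_mem γ h1))
  have h4 : ((α * δ - γ * β : ℚ) : ℝ) ≠ 0 := by exact_mod_cast h
  have h5 : (((α * δ - γ * β)⁻¹ : ℚ) : ℝ) * (α * (γ * x + δ * ζ) - γ * (α * x + β * ζ)) = ζ := by
    push_cast at h4 ⊢
    field_simp
    ring
  rwa [h5] at h3

theorem mem_of_ratCast_mul_mem {M : Submodule ℚ ℝ} {q : ℚ} {x : ℝ} (hq : q ≠ 0)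
    (h : q * x ∈ M) : x ∈ M := by
  have h3 := ratCast_mul_mem q⁻¹ h
  have h4 : (q : ℝ) ≠ 0 := by exact_mod_cast hq
  rwa [Rat.cast_inv, inv_mul_cancel_left₀ h4] at h3

theorem derivT_eq_reT (k s : ℕ) (y : ℚ) : derivT k ((y : ℂ) * sqrtNeg s) = (reT k s 0 y : ℂ) := by
  have h : (y : ℂ) * sqrtNeg s = quadPoint s 0 y := by simp [quadPoint]
  have hr : (quadPoint s 0 y).re = 0 := by rw [quadPoint_re, Rat.cast_zero]
  rw [h, derivT_eq_maassT k hr, reT]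
  exact (conj_eq_iff_re.mp (conj_eq_iff_im.mpr
    (maassT_quadPoint_im y (n := 0) (by simp)))).symm

theorem exists_of_mem_valueSpan {k s : ℕ} (hk : 1 < k) {D : Finset ℕ}
    (h : zetaReal k ∈ valueSpan k s D) : ∃ (a : ℚ) (c : ℕ → ℚ),
      riemannZeta (k : ℂ) = (a : ℂ) * (√s : ℂ) * (Real.pi : ℂ) ^ k +
        ∑ d ∈ D, (c d : ℂ) * derivT k ((d : ℂ) / 2 * sqrtNeg s) := by
  obtain ⟨a, x, hx, hax⟩ := Submodule.mem_span_insert.mp h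
  obtain ⟨c, hc⟩ := Submodule.mem_span_image_finset_iff_exists_fun' ℚ |>.mp hx
  refine ⟨a, c, ?_⟩
  rw [← ofReal_zetaReal hk, hax, ← hc]
  push_cast
  congr 1
  · rw [Rat.smul_def]; ring
  · refine Finset.sum_congr rfl fun d _ => ?_
    have := derivT_eq_reT k s (d / 2)
    push_cast at this
    rw [this, Rat.smul_def]

/-! ### Relations between the values -/

theorem reT_congr (k s : ℕ) {x x' : ℚ} (y : ℚ) (n : ℤ) (h : x' = x + n ∨ x' = -x + n) :
    reT k s x' y = reT k s x y := by
  rcases h with rfl | rfl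
  · rw [reT_add_intCast]
  · rw [reT_add_intCast, reT_neg]

theorem reT_hecke_two (k : ℕ) {s : ℕ} (hs : 0 < s) (x : ℚ) {y : ℚ} (hy : 0 < y) :
    reT k s (x / 2) (y / 2) + reT k s ((x + 1) / 2) (y / 2) = 2 * reT k s x y +
      ((1 / 2 ^ k : ℚ) : ℝ) * (2 * reT k s x y - 2 * reT k s (2 * x) (2 * y)) := by
  have h := reT_hecke k Nat.prime_two hs x hy
  simpa only [Finset.sum_range_succ, Finset.sum_range_zero, zero_add, Nat.cast_zero, add_zero,
    Nat.cast_one, Nat.cast_ofNat] using h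

theorem reT_hecke_three (k : ℕ) {s : ℕ} (hs : 0 < s) (x : ℚ) {y : ℚ} (hy : 0 < y) :
    reT k s (x / 3) (y / 3) + reT k s ((x + 1) / 3) (y / 3) + reT k s ((x + 2) / 3) (y / 3) =
      3 * reT k s x y +
      ((1 / 3 ^ k : ℚ) : ℝ) * (3 * reT k s x y - 3 * reT k s (3 * x) (3 * y)) := by
  have h := reT_hecke k Nat.prime_three hs x hy
  simpa only [Finset.sum_range_succ, Finset.sum_range_zero, zero_add, Nat.cast_zero, add_zero,
    Nat.cast_one, Nat.cast_ofNat] using h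

theorem reT_hecke_five (k : ℕ) {s : ℕ} (hs : 0 < s) (x : ℚ) {y : ℚ} (hy : 0 < y) :
    reT k s (x / 5) (y / 5) + reT k s ((x + 1) / 5) (y / 5) + reT k s ((x + 2) / 5) (y / 5) +
      reT k s ((x + 3) / 5) (y / 5) + reT k s ((x + 4) / 5) (y / 5) =
      5 * reT k s x y +
      ((1 / 5 ^ k : ℚ) : ℝ) * (5 * reT k s x y - 5 * reT k s (5 * x) (5 * y)) := by
  have h := reT_hecke k Nat.prime_five hs x hy
  simpa only [Finset.sum_range_succ, Finset.sum_range_zero, zero_add, Nat.cast_zero, add_zero,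
    Nat.cast_one, Nat.cast_ofNat] using h

theorem reT_hecke_two_zero (k : ℕ) {s : ℕ} (hs : 0 < s) {y : ℚ} (hy : 0 < y) :
    reT k s 0 (y / 2) + reT k s (1 / 2) (y / 2) = 2 * reT k s 0 y +
      ((1 / 2 ^ k : ℚ) : ℝ) * (2 * reT k s 0 y - 2 * reT k s 0 (2 * y)) := by
  simpa only [zero_div, zero_add, mul_zero] using reT_hecke_two k hs 0 hy

/-- Real parts `1/4` and `3/4` give the same value by reflection and translation; the other folded
Hecke relations arise likewise. -/
theorem reT_hecke_two_half (k : ℕ) {s : ℕ} (hs : 0 < s) {y : ℚ} (hy : 0 < y) :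
    2 * reT k s (1 / 4) (y / 2) = 2 * reT k s (1 / 2) y +
      ((1 / 2 ^ k : ℚ) : ℝ) * (2 * reT k s (1 / 2) y - 2 * reT k s 0 (2 * y)) := by
  have h := reT_hecke_two k hs (1 / 2) hy
  rw [reT_congr k s (x := 1 / 4) (x' := (1 / 2 + 1) / 2) _ 1 (Or.inr (by norm_num)),
    reT_congr k s (x := 0) (x' := (2 * (1 / 2) : ℚ)) _ 1 (Or.inl (by norm_num))] at h
  have e : (1 / 2 / 2 : ℚ) = 1 / 4 := by norm_num
  rw [e] at h
  rw [← h]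
  ring

theorem reT_hecke_three_zero (k : ℕ) {s : ℕ} (hs : 0 < s) {y : ℚ} (hy : 0 < y) :
    reT k s 0 (y / 3) + 2 * reT k s (1 / 3) (y / 3) = 3 * reT k s 0 y +
      ((1 / 3 ^ k : ℚ) : ℝ) * (3 * reT k s 0 y - 3 * reT k s 0 (3 * y)) := by
  have h := reT_hecke_three k hs 0 hy
  rw [reT_congr k s (x := 1 / 3) (x' := (0 + 2 : ℚ) / 3) _ 1 (Or.inr (by norm_num))] at h
  simp only [zero_div, zero_add, mul_zero] at h
  rw [← h]
  ring

theorem reT_hecke_three_half (k : ℕ) {s : ℕ} (hs : 0 < s) {y : ℚ} (hy : 0 < y) :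
    reT k s (1 / 2) (y / 3) + 2 * reT k s (1 / 6) (y / 3) = 3 * reT k s (1 / 2) y +
      ((1 / 3 ^ k : ℚ) : ℝ) * (3 * reT k s (1 / 2) y - 3 * reT k s (1 / 2) (3 * y)) := by
  have h := reT_hecke_three k hs (1 / 2) hy
  rw [reT_congr k s (x := 1 / 6) (x' := (1 / 2 + 2 : ℚ) / 3) _ 1 (Or.inr (by norm_num)),
    reT_congr k s (x := 1 / 2) (x' := (3 * (1 / 2) : ℚ)) _ 1 (Or.inl (by norm_num))] at h
  have e : (1 / 2 / 3 : ℚ) = 1 / 6 := by norm_num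
  have e' : ((1 / 2 + 1) / 3 : ℚ) = 1 / 2 := by norm_num
  rw [e, e'] at h
  rw [← h]
  ring

theorem reT_hecke_five_zero (k : ℕ) {s : ℕ} (hs : 0 < s) {y : ℚ} (hy : 0 < y) :
    reT k s 0 (y / 5) + 2 * reT k s (1 / 5) (y / 5) + 2 * reT k s (2 / 5) (y / 5) =
      5 * reT k s 0 y +
      ((1 / 5 ^ k : ℚ) : ℝ) * (5 * reT k s 0 y - 5 * reT k s 0 (5 * y)) := by
  have h := reT_hecke_five k hs 0 hy
  rw [reT_congr k s (x := 1 / 5) (x' := (0 + 4 : ℚ) / 5) _ 1 (Or.inr (by norm_num)),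
    reT_congr k s (x := 2 / 5) (x' := (0 + 3 : ℚ) / 5) _ 1 (Or.inr (by norm_num))] at h
  simp only [zero_div, zero_add, mul_zero] at h
  rw [← h]
  ring

/-! ### The five families -/

/-- The Hecke relation at 2 is used at `√-7` and at `(1 + √-7)/2`. It closes up because `(1 + √-7)/4
= -1/((-1 + √-7)/2)`. Eliminating the value at `(1 + √-7)/2` leaves the coefficient `1 - ρ`, which
is at least `1/2`. -/
theorem zetaReal_mem_sqrt_seven {k : ℕ} (hk : Odd k) (hk1 : 1 < k) :
    zetaReal k ∈ valueSpan k 7 {1, 2, 4} := by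
  have h1 := reT_hecke_two_zero k (s := 7) (by norm_num) (y := 1) one_pos
  have h2 := reT_hecke_two_half k (s := 7) (by norm_num) (y := 1 / 2) (by norm_num)
  obtain ⟨ρ, q, hρ, h3⟩ := reT_neg_one_div_le hk hk1 (s := 7) (by norm_num) (x := -1 / 2)
    (y := 1 / 2) (by norm_num) (n := -1) (by norm_num)
  rw [reT_congr k 7 (x := 1 / 2) (x' := -1 / 2) _ 0 (Or.inr (by norm_num))] at h3
  have e1 : (-1 / 2 : ℚ) ^ 2 + (7 : ℕ) * (1 / 2) ^ 2 = 2 := by norm_num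
  have e2 : (-(-1 / 2) / 2 : ℚ) = 1 / 4 := by norm_num
  have e3 : (2 * (1 / 2) : ℚ) = 1 := by norm_num
  rw [e1] at hρ h3
  rw [e2] at h3
  rw [e3] at h2
  have hρ1 : ρ ≤ 1 / 2 := (le_abs_self ρ).trans (hρ.trans
    (pow_le_of_le_one (by norm_num) (by norm_num) (by obtain ⟨j, rfl⟩ := hk; omega)))
  have t1 : reT k 7 0 (1 / 2) ∈ valueSpan k 7 {1, 2, 4} :=
    reT_mem_valueSpan 1 (by simp) (by norm_num)
  have t2 : reT k 7 0 1 ∈ valueSpan k 7 {1, 2, 4} :=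
    reT_mem_valueSpan 2 (by simp) (by norm_num)
  have t4 : reT k 7 0 (2 * 1) ∈ valueSpan k 7 {1, 2, 4} :=
    reT_mem_valueSpan 4 (by simp) (by norm_num)
  have tP := sqrt_mul_pi_pow_mem k 7 {1, 2, 4}
  generalize valueSpan k 7 {1, 2, 4} = M at *
  set ε : ℚ := 1 / 2 ^ k
  refine mem_of_eliminate (M := M) (x := reT k 7 (1 / 2) (1 / 2)) (α := 1) (β := 0)
    (γ := 2 + 2 * ε - 2 * ρ) (δ := 1 - ρ) (by linarith) ?_ ?_
  · have : ((1 : ℚ) : ℝ) * reT k 7 (1 / 2) (1 / 2) + ((0 : ℚ) : ℝ) * zetaReal k =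
        ((2 + 2 * ε : ℚ) : ℝ) * reT k 7 0 1 - ((2 * ε : ℚ) : ℝ) * reT k 7 0 (2 * 1) -
          reT k 7 0 (1 / 2) := by
      push_cast
      linear_combination h1
    rw [this]
    exact M.sub_mem (M.sub_mem (ratCast_mul_mem _ t2) (ratCast_mul_mem _ t4)) t1
  · have : ((2 + 2 * ε - 2 * ρ : ℚ) : ℝ) * reT k 7 (1 / 2) (1 / 2) +
        ((1 - ρ : ℚ) : ℝ) * zetaReal k =
        ((2 * ε : ℚ) : ℝ) * reT k 7 0 1 - ((2 * q : ℚ) : ℝ) * (√(7 : ℕ) * Real.pi ^ k) := by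
      push_cast at h3 ⊢
      linear_combination 2 * h3 - h2
    rw [this]
    exact M.sub_mem (ratCast_mul_mem _ t2) (ratCast_mul_mem _ tP)

/-- The Hecke relation at 3 at `√-2` suffices, since `√-2/3 = -1/(3√-2/2)` and `(1 + √-2)/3 = -1/(-1
+ √-2)`; no unwanted value appears. -/
theorem zetaReal_mem_sqrt_two {k : ℕ} (hk : Odd k) (hk1 : 1 < k) :
    zetaReal k ∈ valueSpan k 2 {2, 3, 6} := by
  have h1 := reT_hecke_three_zero k (s := 2) (by norm_num) (y := 1) one_pos
  obtain ⟨ρ, q, hρ, h2⟩ := reT_neg_one_div_le hk hk1 (s := 2) (by norm_num) (x := 0)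
    (y := 3 / 2) (by norm_num) (n := 0) (by norm_num)
  obtain ⟨ρ', q', hρ', h3⟩ := reT_neg_one_div_le hk hk1 (s := 2) (by norm_num) (x := -1)
    (y := 1) (by norm_num) (n := -2) (by norm_num)
  rw [reT_congr k 2 (x := 0) (x' := -1) _ (-1) (Or.inl (by norm_num))] at h3
  have e1 : (0 : ℚ) ^ 2 + (2 : ℕ) * (3 / 2) ^ 2 = 9 / 2 := by norm_num
  have e2 : (-1 : ℚ) ^ 2 + (2 : ℕ) * 1 ^ 2 = 3 := by norm_num
  have e3 : (-0 / (9 / 2) : ℚ) = 0 := by norm_num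
  have e4 : (3 / 2 / (9 / 2) : ℚ) = 1 / 3 := by norm_num
  have e5 : (-(-1) / 3 : ℚ) = 1 / 3 := by norm_num
  rw [e1] at hρ h2
  rw [e2] at hρ' h3
  rw [e3, e4] at h2
  rw [e5] at h3
  have hk' : (k - 1) / 2 ≠ 0 := by obtain ⟨j, rfl⟩ := hk; omega
  have hρ1 : ρ ≤ 2 / 9 := (le_abs_self ρ).trans (hρ.trans
    ((pow_le_of_le_one (by norm_num) (by norm_num) hk').trans (by norm_num)))
  have hρ1' : ρ' ≤ 1 / 3 := (le_abs_self ρ').trans (hρ'.trans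
    (pow_le_of_le_one (by norm_num) (by norm_num) hk'))
  have t2 : reT k 2 0 1 ∈ valueSpan k 2 {2, 3, 6} :=
    reT_mem_valueSpan 2 (by simp) (by norm_num)
  have t3 : reT k 2 0 (3 / 2) ∈ valueSpan k 2 {2, 3, 6} :=
    reT_mem_valueSpan 3 (by simp) (by norm_num)
  have t6 : reT k 2 0 (3 * 1) ∈ valueSpan k 2 {2, 3, 6} :=
    reT_mem_valueSpan 6 (by simp) (by norm_num)
  have tP := sqrt_mul_pi_pow_mem k 2 {2, 3, 6}
  generalize valueSpan k 2 {2, 3, 6} = M at *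
  set ε : ℚ := 1 / 3 ^ k
  refine mem_of_ratCast_mul_mem (q := (1 - ρ) / 2 + (1 - ρ')) (by linarith) ?_
  have : (((1 - ρ) / 2 + (1 - ρ') : ℚ) : ℝ) * zetaReal k =
      (ρ : ℝ) * reT k 2 0 (3 / 2) + ((2 * ρ' - 3 - 3 * ε : ℚ) : ℝ) * reT k 2 0 1 +
        ((3 * ε : ℚ) : ℝ) * reT k 2 0 (3 * 1) -
        ((q + 2 * q' : ℚ) : ℝ) * (√(2 : ℕ) * Real.pi ^ k) := by
    push_cast at h2 h3 ⊢
    linear_combination h2 + 2 * h3 - h1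
  rw [this]
  exact M.sub_mem (M.add_mem (M.add_mem (ratCast_mul_mem _ t3) (ratCast_mul_mem _ t2))
    (ratCast_mul_mem _ t6)) (ratCast_mul_mem _ tP)

theorem quadPoint_pow_eq {s l : ℕ} {x y r : ℚ} (h : quadPoint s x y ^ l = quadPoint s r 0) :
    quadPoint s x y ^ l = r := by
  rw [h, quadPoint_zero_right]

/-- The relation from the Hecke operator at `2` at the point `i`. -/
theorem exists_relation_I (m : ℕ) : ∃ q : ℚ,
    ((2 + 2 * (1 / 2 ^ (4 * m + 3)) - 1 / (2 * (-4) ^ m) : ℚ) : ℝ) * reT (4 * m + 3) 1 0 1 +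
      (((1 - 1 / (4 * 16 ^ m)) / 2 + (1 - 1 / (2 * (-4) ^ m)) / 2 : ℚ) : ℝ) *
        zetaReal (4 * m + 3) =
      ((1 / (4 * 16 ^ m) + 2 * (1 / 2 ^ (4 * m + 3)) : ℚ) : ℝ) * reT (4 * m + 3) 1 0 2 +
        (q : ℝ) * (√(1 : ℕ) * Real.pi ^ (4 * m + 3)) := by
  have h1 := reT_hecke_two_zero (4 * m + 3) (s := 1) one_pos (y := 1) one_pos
  -- The two points are `i/2 = -1/(2i)` and `(1 + i)/2 = -1/(-1 + i)`, with fourth powers `(2i)^4 =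
  -- 16` and `(-1 + i)^4 = -4`.
  obtain ⟨q1, h2⟩ := reT_neg_one_div_of_pow (l := 4) (m := m) (by decide) (s := 1) one_pos
    (x := 0) (y := 2) (by norm_num) (n := 0) (by norm_num) (r := 16)
    (quadPoint_pow_eq (by simp only [pow_succ, pow_zero, one_mul, quadPoint_mul]; norm_num))
    (N := 4) (x' := 0) (y' := 1 / 2) (by norm_num) (by norm_num) (by norm_num)
  obtain ⟨q2, h3⟩ := reT_neg_one_div_of_pow (l := 4) (m := m) (by decide) (s := 1) one_pos
    (x := -1) (y := 1) (by norm_num) (n := -2) (by norm_num) (r := -4)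
    (quadPoint_pow_eq (by simp only [pow_succ, pow_zero, one_mul, quadPoint_mul]; norm_num))
    (N := 2) (x' := 1 / 2) (y' := 1 / 2) (by norm_num) (by norm_num) (by norm_num)
  rw [reT_congr _ 1 (x := 0) (x' := -1) _ (-1) (Or.inl (by norm_num))] at h3
  have e : (2 * 1 : ℚ) = 2 := by norm_num
  rw [e] at h1
  refine ⟨-(q1 + q2), ?_⟩
  push_cast at h1 h2 h3 ⊢
  linear_combination h2 + h3 - h1

/-! ### Nonvanishing of the determinants -/

theorem abs_inv_neg_pow (r : ℚ) (hr : 0 ≤ r) (m : ℕ) : |1 / (-r) ^ m| = 1 / r ^ m := by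
  rw [abs_div, abs_pow, abs_neg, abs_one, abs_of_nonneg hr]

theorem inv_pow_le_mul {a b : ℚ} (ha : 0 < a) (hab : a ≤ b) {m : ℕ} (hm : m ≠ 0) :
    1 / b ^ m ≤ a / b * (1 / a ^ m) := by
  have hb := ha.trans_le hab
  have h : (a / b) ^ m ≤ a / b :=
    pow_le_of_le_one (by positivity) ((div_le_one hb).mpr hab) hm
  rw [div_pow] at h
  have h1 : 0 < a ^ m := by positivity
  have h2 : 0 < b ^ m := by positivity
  calc 1 / b ^ m = a ^ m / b ^ m * (1 / a ^ m) := by field_simp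
    _ ≤ _ := by gcongr

/-- With `u, v, b, c` the inverse `m`-th powers of `16, 81, -4, -81/4`, the constant terms and the
terms linear in `b` alone cancel. What remains is `3u/4 - (2v/9)(1 - b/4) - (4c/9)(1 - b/4 + u/8)`,
where `u` dominates. -/
theorem det_three_ne_zero (m : ℕ) :
    (2 + 2 * (1 / 2 ^ (4 * m + 3)) - 1 / (2 * (-4) ^ m) : ℚ) *
      ((1 - 1 / (9 * 81 ^ m)) / 2 + (1 - 1 / (9 / 2 * (-(81 / 4)) ^ m))) -
    (3 + 3 * (1 / 3 ^ (4 * m + 3))) *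
      ((1 - 1 / (4 * 16 ^ m)) / 2 + (1 - 1 / (2 * (-4) ^ m)) / 2) ≠ 0 := by
  -- The crude bounds are too weak at `m = 0`; for `m ≥ 1` each ratio gains a factor from
  -- `inv_pow_le_mul`.
  rcases eq_or_ne m 0 with rfl | hm
  · norm_num
  · have e1 : (2 : ℚ) ^ (4 * m + 3) = 8 * 16 ^ m := by rw [pow_add, pow_mul]; norm_num; ring
    have e2 : (3 : ℚ) ^ (4 * m + 3) = 27 * 81 ^ m := by rw [pow_add, pow_mul]; norm_num; ring
    have hb := abs_inv_neg_pow 4 (by norm_num) m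
    have hc := abs_inv_neg_pow (81 / 4) (by norm_num) m
    have hb' : (1 : ℚ) / 4 ^ m ≤ 1 / 4 := by
      have := inv_pow_le_mul (a := 1) (b := 4) one_pos (by norm_num) hm
      simpa using this
    have hu' := inv_pow_le_mul (a := 1) (b := 16) one_pos (by norm_num) hm
    have hc' := inv_pow_le_mul (a := 16) (b := 81 / 4) (by norm_num) (by norm_num) hm
    have hv' := inv_pow_le_mul (a := 16) (b := 81) (by norm_num) (by norm_num) hm
    have hu : (0 : ℚ) < 1 / 16 ^ m := by positivity
    have hv : (0 : ℚ) < 1 / 81 ^ m := by positivity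
    rw [one_pow] at hu'
    rw [← hc] at hc'
    rw [← hb] at hb'
    rw [e1, e2, ← one_div_mul_one_div, ← one_div_mul_one_div, ← one_div_mul_one_div,
      ← one_div_mul_one_div, ← one_div_mul_one_div, ← one_div_mul_one_div]
    generalize (1 : ℚ) / 16 ^ m = u at *
    generalize (1 : ℚ) / 81 ^ m = v at *
    generalize (1 : ℚ) / (-4) ^ m = b at *
    generalize (1 : ℚ) / (-(81 / 4)) ^ m = c at *
    have h1 := abs_le.mp hb'
    have h2 : |c * (1 - b / 4 + u / 8)| ≤ 16 / (81 / 4) * u * (9 / 8) := by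
      rw [abs_mul]
      refine mul_le_mul hc' ?_ (abs_nonneg _) (by positivity)
      rw [abs_le]; constructor <;> linarith
    have h3 := abs_le.mp h2
    have h4 : v * (1 - b / 4) ≤ 16 / 81 * u * (9 / 8) :=
      mul_le_mul hv' (by linarith) (by linarith) (by positivity)
    apply ne_of_gt
    nlinarith

/-- In the same notation, with `625` and `-625/4` in place of `81` and `-81/4`, the determinant is
`(5 - 2ρ)u/4 - (2v/25)(1 - b/4) - (4c/25)(1 - b/4 + u/8)`. The unknown `ρ` only multiplies the
dominant term, so a bound on it is enough. -/
theorem det_five_ne_zero (m : ℕ) {ρ : ℚ} (hρ : |ρ| ≤ 1 / 5) :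
    (2 + 2 * (1 / 2 ^ (4 * m + 3)) - 1 / (2 * (-4) ^ m) : ℚ) *
      ((1 - 1 / (25 * 625 ^ m)) / 2 + (1 - 1 / (25 / 2 * (-(625 / 4)) ^ m)) + (1 - ρ)) -
    (5 + 5 * (1 / 5 ^ (4 * m + 3)) - 2 * ρ) *
      ((1 - 1 / (4 * 16 ^ m)) / 2 + (1 - 1 / (2 * (-4) ^ m)) / 2) ≠ 0 := by
  have e1 : (2 : ℚ) ^ (4 * m + 3) = 8 * 16 ^ m := by rw [pow_add, pow_mul]; norm_num; ring
  have e2 : (5 : ℚ) ^ (4 * m + 3) = 125 * 625 ^ m := by rw [pow_add, pow_mul]; norm_num; ring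
  have hb := abs_inv_neg_pow 4 (by norm_num) m
  have hc := abs_inv_neg_pow (625 / 4) (by norm_num) m
  have hb' : (1 : ℚ) / 4 ^ m ≤ 1 :=
    div_le_one_of_le₀ (one_le_pow₀ (by norm_num)) (by positivity)
  have hu' : (1 : ℚ) / 16 ^ m ≤ 1 :=
    div_le_one_of_le₀ (one_le_pow₀ (by norm_num)) (by positivity)
  have hc' : (1 : ℚ) / (625 / 4) ^ m ≤ 1 / 16 ^ m := by gcongr; norm_num
  have hv' : (1 : ℚ) / 625 ^ m ≤ 1 / 16 ^ m := by gcongr; norm_num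
  have hu : (0 : ℚ) < 1 / 16 ^ m := by positivity
  have hv : (0 : ℚ) < 1 / 625 ^ m := by positivity
  rw [← hc] at hc'
  rw [← hb] at hb'
  rw [e1, e2, ← one_div_mul_one_div, ← one_div_mul_one_div, ← one_div_mul_one_div,
    ← one_div_mul_one_div, ← one_div_mul_one_div, ← one_div_mul_one_div]
  generalize (1 : ℚ) / 16 ^ m = u at *
  generalize (1 : ℚ) / 625 ^ m = v at *
  generalize (1 : ℚ) / (-4) ^ m = b at *
  generalize (1 : ℚ) / (-(625 / 4)) ^ m = c at *
  have h1 := abs_le.mp hb'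
  have h5 := abs_le.mp hρ
  have h2 : |c * (1 - b / 4 + u / 8)| ≤ u * (11 / 8) := by
    rw [abs_mul]
    refine mul_le_mul hc' ?_ (abs_nonneg _) hu.le
    rw [abs_le]; constructor <;> linarith
  have h3 := abs_le.mp h2
  have h4 : v * (1 - b / 4) ≤ u * (5 / 4) :=
    mul_le_mul hv' (by linarith) (by linarith) hu.le
  have h6 : 23 / 25 * u ≤ (1 - 2 * ρ / 5) * u := by gcongr; linarith
  apply ne_of_gt
  nlinarith

/-- With `u, v, b` the inverse `m`-th powers of `64, 729, -27`, the determinant collapses to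
`(9/8)(1 - b/9)u - v/3`, and `v ≤ u`. -/
theorem det_sqrt_three_ne_zero (m : ℕ) :
    (2 + 2 * (1 / 2 ^ (6 * m + 3)) : ℚ) *
      ((1 - 1 / (3 * (-27) ^ m)) / 2 + (1 - 1 / (9 * 729 ^ m))) -
    (3 + 3 * (1 / 3 ^ (6 * m + 3)) - 1 / (3 * (-27) ^ m)) * (1 - 1 / (4 * 64 ^ m)) ≠ 0 := by
  have e1 : (2 : ℚ) ^ (6 * m + 3) = 8 * 64 ^ m := by rw [pow_add, pow_mul]; norm_num; ring
  have e2 : (3 : ℚ) ^ (6 * m + 3) = 27 * 729 ^ m := by rw [pow_add, pow_mul]; norm_num; ring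
  have hb := abs_inv_neg_pow 27 (by norm_num) m
  have hb' : (1 : ℚ) / 27 ^ m ≤ 1 :=
    div_le_one_of_le₀ (one_le_pow₀ (by norm_num)) (by positivity)
  have hv' : (1 : ℚ) / 729 ^ m ≤ 1 / 64 ^ m := by gcongr; norm_num
  have hu : (0 : ℚ) < 1 / 64 ^ m := by positivity
  rw [← hb] at hb'
  rw [e1, e2, ← one_div_mul_one_div, ← one_div_mul_one_div, ← one_div_mul_one_div,
    ← one_div_mul_one_div, ← one_div_mul_one_div]
  generalize (1 : ℚ) / 64 ^ m = u at *
  generalize (1 : ℚ) / 729 ^ m = v at *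
  generalize (1 : ℚ) / (-27) ^ m = b at *
  have h1 := abs_le.mp hb'
  have h6 : 8 / 9 * u ≤ (1 - b / 9) * u := by gcongr; linarith
  apply ne_of_gt
  nlinarith

/-- The Hecke relations at 2 and at 3 at the point `i` both contain `T_k(i)`, which is eliminated.
The point `(1 + i)/3` inverts to `(-3 + 3i)/2`, a translate of `(1 + 3i)/2`; the Hecke relation at 2
at `3i` trades that value for those at `3i/2`, `3i` and `6i`. -/
theorem zetaReal_mem_three (m : ℕ) :
    zetaReal (4 * m + 3) ∈ valueSpan (4 * m + 3) 1 {3, 4, 6, 12} := by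
  obtain ⟨q0, h0⟩ := exists_relation_I m
  have h1 := reT_hecke_three_zero (4 * m + 3) (s := 1) one_pos (y := 1) one_pos
  have h2 := reT_hecke_two_zero (4 * m + 3) (s := 1) one_pos (y := 3) (by norm_num)
  obtain ⟨q1, h3⟩ := reT_neg_one_div_of_pow (l := 4) (m := m) (by decide) (s := 1) one_pos
    (x := 0) (y := 3) (by norm_num) (n := 0) (by norm_num) (r := 81)
    (quadPoint_pow_eq (by simp only [pow_succ, pow_zero, one_mul, quadPoint_mul]; norm_num))
    (N := 9) (x' := 0) (y' := 1 / 3) (by norm_num) (by norm_num) (by norm_num)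
  obtain ⟨q2, h4⟩ := reT_neg_one_div_of_pow (l := 4) (m := m) (by decide) (s := 1) one_pos
    (x := -3 / 2) (y := 3 / 2) (by norm_num) (n := -3) (by norm_num) (r := -(81 / 4))
    (quadPoint_pow_eq (by simp only [pow_succ, pow_zero, one_mul, quadPoint_mul]; norm_num))
    (N := 9 / 2) (x' := 1 / 3) (y' := 1 / 3) (by norm_num) (by norm_num) (by norm_num)
  rw [reT_congr _ 1 (x := 1 / 2) (x' := -3 / 2) _ (-2) (Or.inl (by norm_num))] at h4
  have e : (3 * 1 : ℚ) = 3 := by norm_num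
  rw [e] at h1
  have hdet := det_three_ne_zero m
  set k := 4 * m + 3
  have t3 : reT k 1 0 (3 / 2) ∈ valueSpan k 1 {3, 4, 6, 12} :=
    reT_mem_valueSpan 3 (by simp) (by norm_num)
  have t4 : reT k 1 0 2 ∈ valueSpan k 1 {3, 4, 6, 12} :=
    reT_mem_valueSpan 4 (by simp) (by norm_num)
  have t6 : reT k 1 0 3 ∈ valueSpan k 1 {3, 4, 6, 12} :=
    reT_mem_valueSpan 6 (by simp) (by norm_num)
  have t12 : reT k 1 0 (2 * 3) ∈ valueSpan k 1 {3, 4, 6, 12} :=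
    reT_mem_valueSpan 12 (by simp) (by norm_num)
  have tP := sqrt_mul_pi_pow_mem k 1 {3, 4, 6, 12}
  generalize valueSpan k 1 {3, 4, 6, 12} = M at *
  refine mem_of_eliminate hdet (x := reT k 1 0 1) ?_ ?_
  · rw [h0]
    exact M.add_mem (ratCast_mul_mem _ t4) (ratCast_mul_mem _ tP)
  · generalize (1 / (9 * 81 ^ m) : ℚ) = ρ at *
    generalize (1 / (9 / 2 * (-(81 / 4)) ^ m) : ℚ) = ρ' at *
    generalize (1 / 2 ^ k : ℚ) = ε at *
    generalize (1 / 3 ^ k : ℚ) = δ at *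
    have : ((3 + 3 * δ : ℚ) : ℝ) * reT k 1 0 1 +
        (((1 - ρ) / 2 + (1 - ρ') : ℚ) : ℝ) * zetaReal k =
        ((ρ + 3 * δ + 2 * ρ' * (2 + 2 * ε) : ℚ) : ℝ) * reT k 1 0 3 -
        ((2 * ρ' * 2 * ε : ℚ) : ℝ) * reT k 1 0 (2 * 3) - ((2 * ρ' : ℚ) : ℝ) * reT k 1 0 (3 / 2) -
        ((q1 + 2 * q2 : ℚ) : ℝ) * (√(1 : ℕ) * Real.pi ^ k) := by
      push_cast at h3 h4 ⊢
      linear_combination h3 + 2 * h4 - h1 + 2 * (ρ' : ℝ) * h2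
    rw [this]
    exact M.sub_mem (M.sub_mem (M.sub_mem (ratCast_mul_mem _ t6) (ratCast_mul_mem _ t12))
      (ratCast_mul_mem _ t3)) (ratCast_mul_mem _ tP)

theorem zetaReal_mem_five (m : ℕ) :
    zetaReal (4 * m + 3) ∈ valueSpan (4 * m + 3) 1 {4, 5, 10, 20} := by
  obtain ⟨q0, h0⟩ := exists_relation_I m
  have h1 := reT_hecke_five_zero (4 * m + 3) (s := 1) one_pos (y := 1) one_pos
  have h2 := reT_hecke_two_zero (4 * m + 3) (s := 1) one_pos (y := 5) (by norm_num)
  obtain ⟨q1, h3⟩ := reT_neg_one_div_of_pow (l := 4) (m := m) (by decide) (s := 1) one_pos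
    (x := 0) (y := 5) (by norm_num) (n := 0) (by norm_num) (r := 625)
    (quadPoint_pow_eq (by simp only [pow_succ, pow_zero, one_mul, quadPoint_mul]; norm_num))
    (N := 25) (x' := 0) (y' := 1 / 5) (by norm_num) (by norm_num) (by norm_num)
  obtain ⟨q2, h4⟩ := reT_neg_one_div_of_pow (l := 4) (m := m) (by decide) (s := 1) one_pos
    (x := -5 / 2) (y := 5 / 2) (by norm_num) (n := -5) (by norm_num) (r := -(625 / 4))
    (quadPoint_pow_eq (by simp only [pow_succ, pow_zero, one_mul, quadPoint_mul]; norm_num))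
    (N := 25 / 2) (x' := 1 / 5) (y' := 1 / 5) (by norm_num) (by norm_num) (by norm_num)
  rw [reT_congr _ 1 (x := 1 / 2) (x' := -5 / 2) _ (-3) (Or.inl (by norm_num))] at h4
  -- The new point is `(2 + i)/5 = -1/(-2 + i)`. As `(-2 + i)^4` is not rational, its coefficient is
  -- only bounded, by `1/5`.
  obtain ⟨ρ₂, q3, hρ, h5⟩ := reT_neg_one_div_le (k := 4 * m + 3)
    (((by decide : Even 4).mul_right m).add_odd (by decide)) (by omega) (s := 1) one_pos
    (x := -2) (y := 1) (by norm_num) (n := -4) (by norm_num)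
  rw [reT_congr _ 1 (x := 0) (x' := -2) _ (-2) (Or.inl (by norm_num))] at h5
  have e : (5 * 1 : ℚ) = 5 := by norm_num
  have e1 : (-2 : ℚ) ^ 2 + (1 : ℕ) * 1 ^ 2 = 5 := by norm_num
  have e2 : (-(-2) / 5 : ℚ) = 2 / 5 := by norm_num
  rw [e] at h1
  rw [e1] at hρ h5
  rw [e2] at h5
  have hdet := det_five_ne_zero m (hρ.trans (pow_le_of_le_one (by norm_num) (by norm_num)
    (by omega)))
  set k := 4 * m + 3
  have t4 : reT k 1 0 2 ∈ valueSpan k 1 {4, 5, 10, 20} :=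
    reT_mem_valueSpan 4 (by simp) (by norm_num)
  have t5 : reT k 1 0 (5 / 2) ∈ valueSpan k 1 {4, 5, 10, 20} :=
    reT_mem_valueSpan 5 (by simp) (by norm_num)
  have t10 : reT k 1 0 5 ∈ valueSpan k 1 {4, 5, 10, 20} :=
    reT_mem_valueSpan 10 (by simp) (by norm_num)
  have t20 : reT k 1 0 (2 * 5) ∈ valueSpan k 1 {4, 5, 10, 20} :=
    reT_mem_valueSpan 20 (by simp) (by norm_num)
  have tP := sqrt_mul_pi_pow_mem k 1 {4, 5, 10, 20}
  generalize valueSpan k 1 {4, 5, 10, 20} = M at *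
  refine mem_of_eliminate hdet (x := reT k 1 0 1) ?_ ?_
  · rw [h0]
    exact M.add_mem (ratCast_mul_mem _ t4) (ratCast_mul_mem _ tP)
  · generalize (1 / (25 * 625 ^ m) : ℚ) = ρ at *
    generalize (1 / (25 / 2 * (-(625 / 4)) ^ m) : ℚ) = ρ' at *
    generalize (1 / 2 ^ k : ℚ) = ε at *
    generalize (1 / 5 ^ k : ℚ) = δ at *
    have : ((5 + 5 * δ - 2 * ρ₂ : ℚ) : ℝ) * reT k 1 0 1 +
        (((1 - ρ) / 2 + (1 - ρ') + (1 - ρ₂) : ℚ) : ℝ) * zetaReal k =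
        ((ρ + 5 * δ + 2 * ρ' * (2 + 2 * ε) : ℚ) : ℝ) * reT k 1 0 5 -
        ((2 * ρ' * 2 * ε : ℚ) : ℝ) * reT k 1 0 (2 * 5) - ((2 * ρ' : ℚ) : ℝ) * reT k 1 0 (5 / 2) -
        ((q1 + 2 * q2 + 2 * q3 : ℚ) : ℝ) * (√(1 : ℕ) * Real.pi ^ k) := by
      push_cast at h3 h4 h5 ⊢
      linear_combination h3 + 2 * h4 + 2 * h5 - h1 + 2 * (ρ' : ℝ) * h2
    rw [this]
    exact M.sub_mem (M.sub_mem (M.sub_mem (ratCast_mul_mem _ t10) (ratCast_mul_mem _ t20))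
      (ratCast_mul_mem _ t5)) (ratCast_mul_mem _ tP)

/-- The Hecke relations at 2 and at 3 are taken at `(1 + √-3)/2`, whose value is eliminated. The
inverted points `-1 + √-3`, `(-3 + √-3)/2` and `(-3 + 3√-3)/2` have rational sixth powers, and the
Hecke relation at 2 at `3√-3` removes the value at `(1 + 3√-3)/2`. -/
theorem zetaReal_mem_sqrt_three (m : ℕ) :
    zetaReal (6 * m + 3) ∈ valueSpan (6 * m + 3) 3 {2, 3, 6, 12} := by
  have h1 := reT_hecke_two_half (6 * m + 3) (s := 3) (by norm_num) (y := 1 / 2) (by norm_num)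
  have h2 := reT_hecke_three_half (6 * m + 3) (s := 3) (by norm_num) (y := 1 / 2) (by norm_num)
  have h3 := reT_hecke_two_zero (6 * m + 3) (s := 3) (by norm_num) (y := 3) (by norm_num)
  obtain ⟨q1, h4⟩ := reT_neg_one_div_of_pow (l := 6) (m := m) (by decide) (s := 3) (by norm_num)
    (x := -1) (y := 1) (by norm_num) (n := -2) (by norm_num) (r := 64)
    (quadPoint_pow_eq (by simp only [pow_succ, pow_zero, one_mul, quadPoint_mul]; norm_num))
    (N := 4) (x' := 1 / 4) (y' := 1 / 2 / 2) (by norm_num) (by norm_num) (by norm_num)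
  obtain ⟨q2, h5⟩ := reT_neg_one_div_of_pow (l := 6) (m := m) (by decide) (s := 3) (by norm_num)
    (x := -3 / 2) (y := 1 / 2) (by norm_num) (n := -3) (by norm_num) (r := -27)
    (quadPoint_pow_eq (by simp only [pow_succ, pow_zero, one_mul, quadPoint_mul]; norm_num))
    (N := 3) (x' := 1 / 2) (y' := 1 / 2 / 3) (by norm_num) (by norm_num) (by norm_num)
  obtain ⟨q3, h6⟩ := reT_neg_one_div_of_pow (l := 6) (m := m) (by decide) (s := 3) (by norm_num)
    (x := -3 / 2) (y := 3 / 2) (by norm_num) (n := -3) (by norm_num) (r := 729)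
    (quadPoint_pow_eq (by simp only [pow_succ, pow_zero, one_mul, quadPoint_mul]; norm_num))
    (N := 9) (x' := 1 / 6) (y' := 1 / 2 / 3) (by norm_num) (by norm_num) (by norm_num)
  rw [reT_congr _ 3 (x := 0) (x' := -1) _ (-1) (Or.inl (by norm_num))] at h4
  rw [reT_congr _ 3 (x := 1 / 2) (x' := -3 / 2) _ (-2) (Or.inl (by norm_num))] at h5 h6
  have e : (2 * (1 / 2) : ℚ) = 1 := by norm_num
  have e1 : (3 * (1 / 2) : ℚ) = 3 / 2 := by norm_num
  rw [e] at h1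
  rw [e1] at h2
  have hdet := det_sqrt_three_ne_zero m
  set k := 6 * m + 3
  have t2 : reT k 3 0 1 ∈ valueSpan k 3 {2, 3, 6, 12} :=
    reT_mem_valueSpan 2 (by simp) (by norm_num)
  have t3 : reT k 3 0 (3 / 2) ∈ valueSpan k 3 {2, 3, 6, 12} :=
    reT_mem_valueSpan 3 (by simp) (by norm_num)
  have t6 : reT k 3 0 3 ∈ valueSpan k 3 {2, 3, 6, 12} :=
    reT_mem_valueSpan 6 (by simp) (by norm_num)
  have t12 : reT k 3 0 (2 * 3) ∈ valueSpan k 3 {2, 3, 6, 12} :=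
    reT_mem_valueSpan 12 (by simp) (by norm_num)
  have tP := sqrt_mul_pi_pow_mem k 3 {2, 3, 6, 12}
  generalize valueSpan k 3 {2, 3, 6, 12} = M at *
  generalize (1 / (4 * 64 ^ m) : ℚ) = ρ at *
  generalize (1 / (3 * (-27) ^ m) : ℚ) = ρ' at *
  generalize (1 / (9 * 729 ^ m) : ℚ) = ρ₂ at *
  generalize (1 / 2 ^ k : ℚ) = ε at *
  generalize (1 / 3 ^ k : ℚ) = δ at *
  refine mem_of_eliminate hdet (x := reT k 3 (1 / 2) (1 / 2)) ?_ ?_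
  · have : ((2 + 2 * ε : ℚ) : ℝ) * reT k 3 (1 / 2) (1 / 2) + ((1 - ρ : ℚ) : ℝ) * zetaReal k =
        ((2 * ρ + 2 * ε : ℚ) : ℝ) * reT k 3 0 1 -
        ((2 * q1 : ℚ) : ℝ) * (√(3 : ℕ) * Real.pi ^ k) := by
      push_cast at h4 ⊢
      linear_combination 2 * h4 - h1
    rw [this]
    exact M.sub_mem (ratCast_mul_mem _ t2) (ratCast_mul_mem _ tP)
  · have : ((3 + 3 * δ - ρ' : ℚ) : ℝ) * reT k 3 (1 / 2) (1 / 2) +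
        (((1 - ρ') / 2 + (1 - ρ₂) : ℚ) : ℝ) * zetaReal k =
        (((2 * ρ₂ + 3 * δ) * (2 + 2 * ε) : ℚ) : ℝ) * reT k 3 0 3 -
        (((2 * ρ₂ + 3 * δ) * (2 * ε) : ℚ) : ℝ) * reT k 3 0 (2 * 3) -
        ((2 * ρ₂ + 3 * δ : ℚ) : ℝ) * reT k 3 0 (3 / 2) -
        ((q2 + 2 * q3 : ℚ) : ℝ) * (√(3 : ℕ) * Real.pi ^ k) := by
      push_cast at h5 h6 ⊢
      linear_combination h5 + 2 * h6 - h2 + (2 * (ρ₂ : ℝ) + 3 * δ) * h3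
    rw [this]
    exact M.sub_mem (M.sub_mem (M.sub_mem (ratCast_mul_mem _ t6) (ratCast_mul_mem _ t12))
      (ratCast_mul_mem _ t3)) (ratCast_mul_mem _ tP)

/-! ### The evaluations of `ζ(3)` -/

/-- This and the other evaluations at `k = 3` reuse the relations of their families, with
`reT_three_neg_one_div` supplying the multiples of `√s π³`; what is left is a rational linear
system. -/
theorem zetaReal_three_sqrt_seven : zetaReal 3 = 7 * √7 / 480 * Real.pi ^ 3 +
    5 / 2 * reT 3 7 0 (1 / 2) - 41 / 8 * reT 3 7 0 1 + 5 / 8 * reT 3 7 0 2 := by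
  have h1 := reT_hecke_two_zero 3 (s := 7) (by norm_num) (y := 1) one_pos
  have h2 := reT_hecke_two_half 3 (s := 7) (by norm_num) (y := 1 / 2) (by norm_num)
  have h3 := reT_three_neg_one_div (s := 7) (by norm_num) (-1 / 2) (y := 1 / 2) (by norm_num)
    (N := 2) (x' := 1 / 4) (y' := 1 / 4) (by norm_num) (by norm_num) (by norm_num)
  rw [reT_congr 3 7 (x := 1 / 2) (x' := -1 / 2) _ 0 (Or.inr (by norm_num))] at h3
  norm_num at h1 h2 h3 ⊢
  linarith

theorem zetaReal_three_sqrt_two : zetaReal 3 = 47 * √2 / 1710 * Real.pi ^ 3 -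
    44 / 19 * reT 3 2 0 1 + 4 / 19 * reT 3 2 0 (3 / 2) + 2 / 19 * reT 3 2 0 3 := by
  have h1 := reT_hecke_three_zero 3 (s := 2) (by norm_num) (y := 1) one_pos
  have h2 := reT_three_neg_one_div (s := 2) (by norm_num) 0 (y := 3 / 2) (by norm_num)
    (N := 9 / 2) (x' := 0) (y' := 1 / 3) (by norm_num) (by norm_num) (by norm_num)
  have h3 := reT_three_neg_one_div (s := 2) (by norm_num) (-1) (y := 1) (by norm_num)
    (N := 3) (x' := 1 / 3) (y' := 1 / 3) (by norm_num) (by norm_num) (by norm_num)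
  rw [reT_congr 3 2 (x := 0) (x' := -1) _ (-1) (Or.inl (by norm_num))] at h3
  norm_num at h1 h2 h3 ⊢
  linarith

/-- The relation from the Hecke operator at `2` at the point `i`, for `k = 3`. -/
theorem relation_I_three :
    reT 3 1 0 1 = 2 / 7 * reT 3 1 0 2 - 5 / 14 * zetaReal 3 + Real.pi ^ 3 / 70 := by
  have h1 := reT_hecke_two_zero 3 (s := 1) one_pos (y := 1) one_pos
  have h2 := reT_three_neg_one_div (s := 1) one_pos 0 (y := 2) (by norm_num)
    (N := 4) (x' := 0) (y' := 1 / 2) (by norm_num) (by norm_num) (by norm_num)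
  have h3 := reT_three_neg_one_div (s := 1) one_pos (-1) (y := 1) (by norm_num)
    (N := 2) (x' := 1 / 2) (y' := 1 / 2) (by norm_num) (by norm_num) (by norm_num)
  rw [reT_congr 3 1 (x := 0) (x' := -1) _ (-1) (Or.inl (by norm_num))] at h3
  norm_num at h1 h2 h3 ⊢
  linarith

theorem zetaReal_three_three : zetaReal 3 = 7 / 180 * Real.pi ^ 3 - 4 * reT 3 1 0 (3 / 2) -
    8 * reT 3 1 0 2 + 11 * reT 3 1 0 3 - reT 3 1 0 6 := by
  have h0 := relation_I_three
  have h1 := reT_hecke_three_zero 3 (s := 1) one_pos (y := 1) one_pos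
  have h2 := reT_hecke_two_zero 3 (s := 1) one_pos (y := 3) (by norm_num)
  have h3 := reT_three_neg_one_div (s := 1) one_pos 0 (y := 3) (by norm_num)
    (N := 9) (x' := 0) (y' := 1 / 3) (by norm_num) (by norm_num) (by norm_num)
  have h4 := reT_three_neg_one_div (s := 1) one_pos (-3 / 2) (y := 3 / 2) (by norm_num)
    (N := 9 / 2) (x' := 1 / 3) (y' := 1 / 3) (by norm_num) (by norm_num) (by norm_num)
  rw [reT_congr _ 1 (x := 1 / 2) (x' := -3 / 2) _ (-2) (Or.inl (by norm_num))] at h4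
  norm_num at h1 h2 h3 h4 ⊢
  linarith

theorem zetaReal_three_five : zetaReal 3 = 221 / 5700 * Real.pi ^ 3 - 232 / 95 * reT 3 1 0 2 -
    28 / 95 * reT 3 1 0 (5 / 2) + 77 / 95 * reT 3 1 0 5 - 7 / 95 * reT 3 1 0 10 := by
  have h0 := relation_I_three
  have h1 := reT_hecke_five_zero 3 (s := 1) one_pos (y := 1) one_pos
  have h2 := reT_hecke_two_zero 3 (s := 1) one_pos (y := 5) (by norm_num)
  have h3 := reT_three_neg_one_div (s := 1) one_pos 0 (y := 5) (by norm_num)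
    (N := 25) (x' := 0) (y' := 1 / 5) (by norm_num) (by norm_num) (by norm_num)
  have h4 := reT_three_neg_one_div (s := 1) one_pos (-5 / 2) (y := 5 / 2) (by norm_num)
    (N := 25 / 2) (x' := 1 / 5) (y' := 1 / 5) (by norm_num) (by norm_num) (by norm_num)
  have h5 := reT_three_neg_one_div (s := 1) one_pos (-2) (y := 1) (by norm_num)
    (N := 5) (x' := 2 / 5) (y' := 1 / 5) (by norm_num) (by norm_num) (by norm_num)
  rw [reT_congr _ 1 (x := 1 / 2) (x' := -5 / 2) _ (-3) (Or.inl (by norm_num))] at h4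
  rw [reT_congr _ 1 (x := 0) (x' := -2) _ (-2) (Or.inl (by norm_num))] at h5
  norm_num at h1 h2 h3 h4 h5 ⊢
  linarith

theorem zetaReal_three_sqrt_three : zetaReal 3 = 43 * √3 / 1920 * Real.pi ^ 3 -
    25 / 8 * reT 3 3 0 1 - 9 / 8 * reT 3 3 0 (3 / 2) + 81 / 32 * reT 3 3 0 3 -
    9 / 32 * reT 3 3 0 6 := by
  have h1 := reT_hecke_two_half 3 (s := 3) (by norm_num) (y := 1 / 2) (by norm_num)
  have h2 := reT_hecke_three_half 3 (s := 3) (by norm_num) (y := 1 / 2) (by norm_num)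
  have h3 := reT_hecke_two_zero 3 (s := 3) (by norm_num) (y := 3) (by norm_num)
  have h4 := reT_three_neg_one_div (s := 3) (by norm_num) (-1) (y := 1) (by norm_num)
    (N := 4) (x' := 1 / 4) (y' := 1 / 4) (by norm_num) (by norm_num) (by norm_num)
  have h5 := reT_three_neg_one_div (s := 3) (by norm_num) (-3 / 2) (y := 1 / 2) (by norm_num)
    (N := 3) (x' := 1 / 2) (y' := 1 / 6) (by norm_num) (by norm_num) (by norm_num)
  have h6 := reT_three_neg_one_div (s := 3) (by norm_num) (-3 / 2) (y := 3 / 2) (by norm_num)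
    (N := 9) (x' := 1 / 6) (y' := 1 / 6) (by norm_num) (by norm_num) (by norm_num)
  rw [reT_congr _ 3 (x := 0) (x' := -1) _ (-1) (Or.inl (by norm_num))] at h4
  rw [reT_congr _ 3 (x := 1 / 2) (x' := -3 / 2) _ (-2) (Or.inl (by norm_num))] at h5 h6
  norm_num at h1 h2 h3 h4 h5 h6 ⊢
  linarith

theorem mainTheorem9 :
    -- the series, `P_k` and `R_k` are well behaved on the upper half-plane
    (∀ k : ℕ, Odd k → 1 < k → ∀ z : ℂ, 0 < z.im →
      (Summable fun n : ℕ => 1 / ((n : ℂ) + 1) ^ k *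
        (Complex.exp (2 * (Real.pi : ℂ) * Complex.I * z) ^ (n + 1) /
          (1 - Complex.exp (2 * (Real.pi : ℂ) * Complex.I * z) ^ (n + 1)))) ∧
      DifferentiableAt ℂ (lambertP k) z ∧ DifferentiableAt ℂ (corrR k) z) ∧
    -- transformation laws of `U_k` and `T_k` under `z ↦ -1/z`
    (∀ k : ℕ, Odd k → 1 < k → ∀ z : ℂ, 0 < z.im →
      z ^ (k - 1) * derivU k (-1 / z) = derivU k z ∧
      z ^ (k - 1) * derivT k (-1 / z) = derivU k z - derivT k z) ∧
    -- `T_k(i) = U_k(i) / 2` for `k = 4n + 1`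
    (∀ n : ℕ, 1 ≤ n →
      derivT (4 * n + 1) Complex.I = 1 / 2 * derivU (4 * n + 1) Complex.I) ∧
    -- Family A, all odd `k = 2n + 1 > 1`
    (∀ n k : ℕ, 1 ≤ n → k = 2 * n + 1 → ∃ (a : ℚ) (c : ℕ → ℚ),
      riemannZeta (k : ℂ) = (a : ℂ) * (Real.sqrt 7 : ℂ) * (Real.pi : ℂ) ^ k
        + ∑ d ∈ ({1, 2, 4} : Finset ℕ), (c d : ℂ) * derivT k ((d : ℂ) / 2 * sqrtNeg 7)) ∧
    -- Family B, all odd `k = 2n + 1 > 1`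
    (∀ n k : ℕ, 1 ≤ n → k = 2 * n + 1 → ∃ (a : ℚ) (c : ℕ → ℚ),
      riemannZeta (k : ℂ) = (a : ℂ) * (Real.sqrt 2 : ℂ) * (Real.pi : ℂ) ^ k
        + ∑ d ∈ ({2, 3, 6} : Finset ℕ), (c d : ℂ) * derivT k ((d : ℂ) / 2 * sqrtNeg 2)) ∧
    -- Family C, `k = 4n - 1`
    (∀ n k : ℕ, 1 ≤ n → k = 4 * n - 1 → ∃ (a : ℚ) (c : ℕ → ℚ),
      riemannZeta (k : ℂ) = (a : ℂ) * (Real.pi : ℂ) ^ k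
        + ∑ d ∈ ({3, 4, 6, 12} : Finset ℕ), (c d : ℂ) * derivT k ((d : ℂ) / 2 * sqrtNeg 1)) ∧
    -- Family D, `k = 4n - 1`
    (∀ n k : ℕ, 1 ≤ n → k = 4 * n - 1 → ∃ (a : ℚ) (c : ℕ → ℚ),
      riemannZeta (k : ℂ) = (a : ℂ) * (Real.pi : ℂ) ^ k
        + ∑ d ∈ ({4, 5, 10, 20} : Finset ℕ), (c d : ℂ) * derivT k ((d : ℂ) / 2 * sqrtNeg 1)) ∧
    -- Family E, `k = 6n - 3`
    (∀ n k : ℕ, 1 ≤ n → k = 6 * n - 3 → ∃ (a : ℚ) (c : ℕ → ℚ),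
      riemannZeta (k : ℂ) = (a : ℂ) * (Real.sqrt 3 : ℂ) * (Real.pi : ℂ) ^ k
        + ∑ d ∈ ({2, 3, 6, 12} : Finset ℕ), (c d : ℂ) * derivT k ((d : ℂ) / 2 * sqrtNeg 3)) ∧
    -- the explicit identities at `k = 3`
    riemannZeta 3 = 7 * (Real.sqrt 7 : ℂ) / 480 * (Real.pi : ℂ) ^ 3
        + 5 / 2 * derivT 3 (1 / 2 * sqrtNeg 7)
        - 41 / 8 * derivT 3 (sqrtNeg 7)
        + 5 / 8 * derivT 3 (2 * sqrtNeg 7) ∧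
    riemannZeta 3 = 47 * (Real.sqrt 2 : ℂ) / 1710 * (Real.pi : ℂ) ^ 3
        - 44 / 19 * derivT 3 (sqrtNeg 2)
        + 4 / 19 * derivT 3 (3 / 2 * sqrtNeg 2)
        + 2 / 19 * derivT 3 (3 * sqrtNeg 2) ∧
    riemannZeta 3 = 7 / 180 * (Real.pi : ℂ) ^ 3
        - 4 * derivT 3 (3 / 2 * sqrtNeg 1)
        - 8 * derivT 3 (2 * sqrtNeg 1)
        + 11 * derivT 3 (3 * sqrtNeg 1)
        - derivT 3 (6 * sqrtNeg 1) ∧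
    riemannZeta 3 = 221 / 5700 * (Real.pi : ℂ) ^ 3
        - 232 / 95 * derivT 3 (2 * sqrtNeg 1)
        - 28 / 95 * derivT 3 (5 / 2 * sqrtNeg 1)
        + 77 / 95 * derivT 3 (5 * sqrtNeg 1)
        - 7 / 95 * derivT 3 (10 * sqrtNeg 1) ∧
    riemannZeta 3 = 43 * (Real.sqrt 3 : ℂ) / 1920 * (Real.pi : ℂ) ^ 3
        - 25 / 8 * derivT 3 (sqrtNeg 3)
        - 9 / 8 * derivT 3 (3 / 2 * sqrtNeg 3)
        + 81 / 32 * derivT 3 (3 * sqrtNeg 3)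
        - 9 / 32 * derivT 3 (6 * sqrtNeg 3) := by
  have hz3 : riemannZeta 3 = (zetaReal 3 : ℂ) := by
    rw [ofReal_zetaReal (by norm_num)]; norm_num
  have hT : ∀ (s : ℕ) (y : ℚ) (w : ℂ), w = y * sqrtNeg s → derivT 3 w = (reT 3 s 0 y : ℂ) :=
    fun s y w hw => hw ▸ derivT_eq_reT 3 s y
  refine ⟨fun k hk hk1 z hz => ⟨summable_lambert (norm_nome_lt_one hz) k,
      differentiableAt_lambertP k hz, (hasDerivAt_corrR hk hk1 hz).differentiableAt⟩,
    fun k hk hk1 z hz => ⟨derivU_transform hk hk1 hz, derivT_transform hk hk1 hz⟩,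
    fun n hn => ?_, fun n k hn hk => ?_, fun n k hn hk => ?_, fun n k hn hk => ?_,
    fun n k hn hk => ?_, fun n k hn hk => ?_, ?_, ?_, ?_, ?_, ?_⟩
  -- The point `i` is fixed by `z ↦ -1/z`, and `i^(k-1) = 1` for `k = 4n + 1`.
  · have h := derivT_transform (k := 4 * n + 1) ⟨2 * n, by ring⟩ (by omega) (z := I) (by simp)
    have e : -1 / I = I := by rw [div_I]; ring
    rw [e, Nat.add_sub_cancel, pow_mul, I_pow_four, one_pow] at h
    linear_combination 1 / 2 * h
  · have h := exists_of_mem_valueSpan (by omega)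
      (zetaReal_mem_sqrt_seven (k := k) ⟨n, hk⟩ (by omega))
    simpa only [Nat.cast_ofNat] using h
  · have h := exists_of_mem_valueSpan (by omega)
      (zetaReal_mem_sqrt_two (k := k) ⟨n, hk⟩ (by omega))
    simpa only [Nat.cast_ofNat] using h
  · obtain ⟨m, rfl⟩ : ∃ m, n = m + 1 := ⟨n - 1, by omega⟩
    obtain rfl : k = 4 * m + 3 := by omega
    have h := exists_of_mem_valueSpan (by omega) (zetaReal_mem_three m)
    simpa only [Nat.cast_one, Real.sqrt_one, ofReal_one, mul_one] using h
  · obtain ⟨m, rfl⟩ : ∃ m, n = m + 1 := ⟨n - 1, by omega⟩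
    obtain rfl : k = 4 * m + 3 := by omega
    have h := exists_of_mem_valueSpan (by omega) (zetaReal_mem_five m)
    simpa only [Nat.cast_one, Real.sqrt_one, ofReal_one, mul_one] using h
  · obtain ⟨m, rfl⟩ : ∃ m, n = m + 1 := ⟨n - 1, by omega⟩
    obtain rfl : k = 6 * m + 3 := by omega
    have h := exists_of_mem_valueSpan (by omega) (zetaReal_mem_sqrt_three m)
    simpa only [Nat.cast_ofNat] using h
  · rw [hz3, hT 7 (1 / 2) _ (by norm_num), hT 7 1 _ (by norm_num), hT 7 2 _ (by norm_num),
      zetaReal_three_sqrt_seven]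
    push_cast; rfl
  · rw [hz3, hT 2 1 (sqrtNeg 2) (by norm_num), hT 2 (3 / 2) _ (by norm_num),
      hT 2 3 _ (by norm_num), zetaReal_three_sqrt_two]
    push_cast; rfl
  · rw [hz3, hT 1 (3 / 2) _ (by norm_num), hT 1 2 _ (by norm_num), hT 1 3 _ (by norm_num),
      hT 1 6 _ (by norm_num), zetaReal_three_three]
    push_cast; rfl
  · rw [hz3, hT 1 2 _ (by norm_num), hT 1 (5 / 2) _ (by norm_num), hT 1 5 _ (by norm_num),
      hT 1 10 _ (by norm_num), zetaReal_three_five]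
    push_cast; rfl
  · rw [hz3, hT 3 1 (sqrtNeg 3) (by norm_num), hT 3 (3 / 2) _ (by norm_num),
      hT 3 3 _ (by norm_num), hT 3 6 _ (by norm_num), zetaReal_three_sqrt_three]
    push_cast; rfl
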